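/- Let $K_1,K_3>0$ and let $\alpha_1,\dots,\alpha_6,\gamma_1,\gamma_2$ be real constants with $$\gamma_1=\alpha_3-\alpha_2,\qquad \gamma_2=\alpha_6-\alpha_5,\qquad \alpha_2+\alpha_3=\alpha_6-\alpha_5,$$ $$\alpha_4>0,\quad 2\alpha_1+3\alpha_4+2\alpha_5+2\alpha_6>0,\quad \gamma_1>0,\quad 2\alpha_4+\alpha_5+\alpha_6>0,\quad 4\gamma_1(2\alpha_4+\alpha_5+\alpha_6)>(\alpha_2+\alpha_3+\gamma_2)^2 .$$ Put $$g(\theta)=\alpha_1\sin^2\theta\cos^2\theta+\tfrac{\alpha_5-\alpha_2}{2}\sin^2\theta+\tfrac{\alpha_3+\alpha_6}{2}\cos^2\theta+\tfrac{\alpha_4}{2},\qquad h(\theta)=\alpha_3\cos^2\theta-\alpha_2\sin^2\theta,$$ $$c(\theta)=\sqrt{K_1\cos^2\theta+K_3\sin^2\theta}.$$ For $0<T\le 1$ consider classical solutions $(\theta,u)=(\theta(x,t),u(x,t))$ on $\mathbb R\times[0,T]$ of $$u_t=\big(g(\theta)u_x+h(\theta)\theta_t\big)_x,\qquad \theta_{tt}+\gamma_1\theta_t=c(\theta)\big(c(\theta)\theta_x\big)_x-h(\theta)u_x,$$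 that is, $\theta,u\in C^2(\mathbb R\times[0,T])$ (in particular $C^\infty$ solutions are included), whose energy $$\mathcal E(t)=\tfrac12\int_{\mathbb R}\big(\theta_t^2+c(\theta)^2\theta_x^2+u^2\big)(x,t)\,dx$$ is finite for every $t\in[0,T]$ and bounded on $[0,T]$. Let $\theta_0=\theta(\cdot,0)$, $$J=u_x+\frac{h(\theta)}{g(\theta)}\theta_t,\qquad J_0=J(\cdot,0),\qquad A_0(x)=\int_{-\infty}^xJ_0(z)\,dz,$$ where the integral is assumed to converge (possibly as an improper integral), and assume that $J_0$, $\theta_0'$ and $A_0$ are bounded. Then there are positive constants $C,C_1,C_2$, depending only on $\alpha_1,\dots,\alpha_6,\gamma_1,\gamma_2,K_1,K_3$ (and not on $T$ or on the solution), such that every such solution with $C\,\mathcal E(0)^{1/2}\le\frac12$ satisfies, for all $x\in\mathbb R$ and $t\in[0,T]$, $$|J(x,t)|\le 2\Big[C\,\mathcal E(0)+C\,\mathcal E(0)^{1/2}+C\|J_0\|_{L^\infty(\mathbb R)}+C_1\|\theta_0'\|_{L^\infty(\mathbb R)}\|A_0\|_{L^\infty(\mathbb R)}+C_2\|A_0\|_{L^\infty(\mathbb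 R)}\Big].$$ In particular, for $T=1$ this bounds $J$ uniformly on $\mathbb R\times[0,1]$. -/

import Mathlib

open Set Filter Topology MeasureTheory

noncomputable section

namespace Poiseuille

/-- Leslie viscosities `α₁, …, α₆`, the coefficients `γ₁, γ₂` and the elastic constants `K₁, K₃`
of a nematic liquid crystal, subject to the compatibility relations, Parodi's relation and the
empirical inequalities. -/
structure Coeffs where
  (α₁ α₂ α₃ α₄ α₅ α₆ γ₁ γ₂ K₁ K₃ : ℝ)
  K₁_pos : 0 < K₁
  K₃_pos : 0 < K₃
  γ₁_eq : γ₁ = α₃ - α₂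
  γ₂_eq : γ₂ = α₆ - α₅
  parodi : α₂ + α₃ = α₆ - α₅
  α₄_pos : 0 < α₄
  ineq₁ : 0 < 2 * α₁ + 3 * α₄ + 2 * α₅ + 2 * α₆
  γ₁_pos : 0 < γ₁
  ineq₂ : 0 < 2 * α₄ + α₅ + α₆
  ineq₃ : (α₂ + α₃ + γ₂) ^ 2 < 4 * γ₁ * (2 * α₄ + α₅ + α₆)

namespace Coeffs

/-- The viscosity function `g`. -/
def g (P : Coeffs) (s : ℝ) : ℝ :=
  P.α₁ * Real.sin s ^ 2 * Real.cos s ^ 2 + (P.α₅ - P.α₂) / 2 * Real.sin s ^ 2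
    + (P.α₃ + P.α₆) / 2 * Real.cos s ^ 2 + P.α₄ / 2

/-- The coupling function `h`. -/
def h (P : Coeffs) (s : ℝ) : ℝ :=
  P.α₃ * Real.cos s ^ 2 - P.α₂ * Real.sin s ^ 2

/-- The wave speed `c`, the positive function with `c² = K₁ cos² + K₃ sin²`. -/
def c (P : Coeffs) (s : ℝ) : ℝ :=
  Real.sqrt (P.K₁ * Real.cos s ^ 2 + P.K₃ * Real.sin s ^ 2)

end Coeffs

/-- Partial derivative in space of a function `f x t`. -/
def ddx (f : ℝ → ℝ → ℝ) (x t : ℝ) : ℝ :=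
  deriv (fun y => f y t) x

/-- Partial derivative in time on the time interval `[0, T]` of a function `f x t`;
it is one-sided at the end points. -/
def ddt (T : ℝ) (f : ℝ → ℝ → ℝ) (x t : ℝ) : ℝ :=
  derivWithin (fun s => f x s) (Icc 0 T) t

/-- Twice the energy density: `θ_t² + c(θ)² θ_x² + u²`. -/
def energyDensity (P : Coeffs) (T : ℝ) (θ u : ℝ → ℝ → ℝ) (x t : ℝ) : ℝ :=
  ddt T θ x t ^ 2 + P.c (θ x t) ^ 2 * ddx θ x t ^ 2 + u x t ^ 2

/-- The energy `𝓔(t) = ½ ∫ θ_t² + c(θ)² θ_x² + u² dx`. -/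
def energy (P : Coeffs) (T : ℝ) (θ u : ℝ → ℝ → ℝ) (t : ℝ) : ℝ :=
  (1 / 2) * ∫ x : ℝ, energyDensity P T θ u x t

/-- The quantity `J = u_x + (h(θ)/g(θ)) θ_t`. -/
def J (P : Coeffs) (T : ℝ) (θ u : ℝ → ℝ → ℝ) (x t : ℝ) : ℝ :=
  ddx u x t + P.h (θ x t) / P.g (θ x t) * ddt T θ x t

/-- `(θ, u)` is a classical solution on `ℝ × [0, T]`, twice continuously differentiable up to
the boundary of the strip, with finite energy at all times, bounded on `[0, T]`:

* `u_t = (g(θ) u_x + h(θ) θ_t)_x`,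
* `θ_tt + γ₁ θ_t = c(θ) (c(θ) θ_x)_x - h(θ) u_x`. -/
structure IsSolution (P : Coeffs) (T : ℝ) (θ u : ℝ → ℝ → ℝ) : Prop where
  smooth_θ : ContDiffOn ℝ 2 (fun p : ℝ × ℝ => θ p.1 p.2) (univ ×ˢ Icc 0 T)
  smooth_u : ContDiffOn ℝ 2 (fun p : ℝ × ℝ => u p.1 p.2) (univ ×ˢ Icc 0 T)
  heat : ∀ x : ℝ, ∀ t ∈ Icc 0 T,
    ddt T u x t = ddx (fun y s => P.g (θ y s) * ddx u y s + P.h (θ y s) * ddt T θ y s) x t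
  wave : ∀ x : ℝ, ∀ t ∈ Icc 0 T,
    ddt T (ddt T θ) x t + P.γ₁ * ddt T θ x t =
      P.c (θ x t) * ddx (fun y s => P.c (θ y s) * ddx θ y s) x t - P.h (θ x t) * ddx u x t
  finite_energy : ∀ t ∈ Icc 0 T, Integrable (fun x => energyDensity P T θ u x t)
  bounded_energy : ∃ M : ℝ, ∀ t ∈ Icc 0 T, energy P T θ u t ≤ M

/-- `A x = ∫_{-∞}^x f`, as a convergent (possibly improper) integral, for every `x`. -/
def IsPotential (f A : ℝ → ℝ) : Prop :=
  ∀ x : ℝ, Tendsto (fun a : ℝ => ∫ z in a..x, f z) atBot (𝓝 (A x))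

/-- `f` is a bounded function on the line. -/
def IsBdd (f : ℝ → ℝ) : Prop :=
  BddAbove (range fun x => |f x|)

/-- The supremum norm; it is the `L^∞` norm when `f` is continuous and bounded. -/
def supNorm (f : ℝ → ℝ) : ℝ :=
  ⨆ x : ℝ, |f x|

end Poiseuille

end

/-!
The quantity `J = u_x + m(θ) θ_t`, `m = h / g`, satisfies `g J = g u_x + h θ_t`, so that the first
equation reads `u_t = (g J)_x`. Inserting the second equation, with the term `-h u_x` also written
as a divergence plus terms quadratic in `(θ_x, u)`, gives
`J_t = (g J)_xx + G_x + Q` (`Flow.hasDerivAt_J`), where, up to constants, `|G|²` is bounded by the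
energy density `e` and `|Q|` by `e + |θ_t|`. As no term of order zero in `J` is left, everything on
the right except the diffusion is controlled by the energy alone.

The energy inequality (`Flow.local_energy_le`) bounds the energy at all times, and the integral of
`u_x²`, by `𝓔(0)`; it rests on the coercivity of the dissipation (`Coeffs.exists_pos_le_g_sub`) and
uses the uniform bound of the energy only to exclude influx from infinity.

For the pointwise bound the equation is tested (`Flow.weak_form`) with a cutoff of radius `ρ` times
the backward heat kernel of `g(θ(x₀, t))`, the viscosity frozen in space at `x₀`. As `θ_x` is in
`L²`, `g(θ)` is Hölder continuous in space with exponent `1 / 2` and a constant of order `√𝓔(0)`.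
This tames the second derivative of the kernel: with `σ` the variance, all spatial integrals are
of order `σ ^ (-3 / 4)`, which is integrable in time (`Flow.slice_le`, `Flow.integral_inv_var_le`).
The result is `Flow.pointwise_le`: `|J(x₀, t₀)|` is at most `sup |J₀|`, plus energy terms of order
`ρ⁻²`, plus `√𝓔(0)` times the maximum of `|J|` near `x₀`. The terms from the cutoff are controlled
by the `L²` norm of `J` in space-time.

The last term has to be absorbed, but `J` is not known to be bounded on the whole line. So
`Flow.abs_J_le` works with the maximum of `(1 - |x - x₁|)² |J|` on the compact set
`[x₁ - 1, x₁ + 1] × [0, T]`, applies the pointwise bound at a maximum point with `ρ` half the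
distance to the boundary of the window, and absorbs by the smallness of `√𝓔(0)`.
-/

noncomputable section

namespace Poiseuille

/-! ### The coefficients -/

namespace Coeffs

/-- The square `c²` of the wave speed. -/
def k (P : Coeffs) (s : ℝ) : ℝ :=
  P.K₁ * Real.cos s ^ 2 + P.K₃ * Real.sin s ^ 2

/-- The derivative of `g`. -/
def dg (P : Coeffs) (s : ℝ) : ℝ :=
  P.α₁ * (2 * Real.sin s * Real.cos s) * (Real.cos s ^ 2 - Real.sin s ^ 2)
    + (P.α₅ - P.α₂ - P.α₃ - P.α₆) * (Real.sin s * Real.cos s)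

/-- The derivative of `h`. -/
def dh (P : Coeffs) (s : ℝ) : ℝ :=
  -(2 * (P.α₂ + P.α₃) * (Real.sin s * Real.cos s))

/-- The derivative of `k`. -/
def dk (P : Coeffs) (s : ℝ) : ℝ :=
  2 * (P.K₃ - P.K₁) * (Real.sin s * Real.cos s)

/-- The ratio `h / g` in the definition of `J`. -/
def m (P : Coeffs) (s : ℝ) : ℝ := P.h s / P.g s

/-- The derivative of `m`. -/
def dm (P : Coeffs) (s : ℝ) : ℝ := (P.dh s * P.g s - P.h s * P.dg s) / P.g s ^ 2

variable (P : Coeffs)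

theorem hasDerivAt_g (s : ℝ) : HasDerivAt P.g (P.dg s) s := by
  have h1 := Real.hasDerivAt_sin s
  have h2 := Real.hasDerivAt_cos s
  have := (((((h1.pow 2).const_mul P.α₁).mul (h2.pow 2)).add
    ((h1.pow 2).const_mul ((P.α₅ - P.α₂) / 2))).add
    ((h2.pow 2).const_mul ((P.α₃ + P.α₆) / 2))).add_const (P.α₄ / 2)
  refine this.congr_deriv ?_
  simp only [dg, Pi.pow_apply]
  push_cast
  ring

theorem hasDerivAt_h (s : ℝ) : HasDerivAt P.h (P.dh s) s := by
  have h1 := Real.hasDerivAt_sin s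
  have h2 := Real.hasDerivAt_cos s
  have := ((h2.pow 2).const_mul P.α₃).sub ((h1.pow 2).const_mul P.α₂)
  refine this.congr_deriv ?_
  simp only [dh]
  push_cast
  ring

theorem hasDerivAt_k (s : ℝ) : HasDerivAt P.k (P.dk s) s := by
  have h1 := Real.hasDerivAt_sin s
  have h2 := Real.hasDerivAt_cos s
  have := ((h2.pow 2).const_mul P.K₁).add ((h1.pow 2).const_mul P.K₃)
  refine this.congr_deriv ?_
  simp only [dk]
  push_cast
  ring

theorem continuous_g : Continuous P.g := by unfold g; fun_prop
theorem continuous_h : Continuous P.h := by unfold h; fun_prop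
theorem continuous_k : Continuous P.k := by unfold k; fun_prop
theorem continuous_dg : Continuous P.dg := by unfold dg; fun_prop
theorem continuous_dh : Continuous P.dh := by unfold dh; fun_prop
theorem continuous_dk : Continuous P.dk := by unfold dk; fun_prop

theorem exists_pos_le_k : ∃ l : ℝ, 0 < l ∧ ∀ s, l ≤ P.k s := by
  refine ⟨min P.K₁ P.K₃, lt_min P.K₁_pos P.K₃_pos, fun s => ?_⟩
  have h1 := mul_le_mul_of_nonneg_right (min_le_left P.K₁ P.K₃) (sq_nonneg (Real.cos s))
  have h2 := mul_le_mul_of_nonneg_right (min_le_right P.K₁ P.K₃) (sq_nonneg (Real.sin s))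
  have h3 := Real.sin_sq_add_cos_sq s
  unfold k
  calc min P.K₁ P.K₃ = min P.K₁ P.K₃ * (Real.sin s ^ 2 + Real.cos s ^ 2) := by rw [h3, mul_one]
    _ ≤ _ := by linarith

theorem k_pos (s : ℝ) : 0 < P.k s := by
  obtain ⟨l, hl, h⟩ := P.exists_pos_le_k
  exact hl.trans_le (h s)

theorem c_sq (s : ℝ) : P.c s ^ 2 = P.k s := Real.sq_sqrt (P.k_pos s).le

theorem c_pos (s : ℝ) : 0 < P.c s := Real.sqrt_pos.2 (P.k_pos s)

theorem hasDerivAt_c (s : ℝ) : HasDerivAt P.c (P.dk s / (2 * P.c s)) s :=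
  (P.hasDerivAt_k s).sqrt (P.k_pos s).ne'

/-- The dissipation `γ₁ q² + 2 h q v + g v²` is uniformly coercive: with `z = cos² - sin²` the
relations between the Leslie coefficients make `g - h² / γ₁` an affine function of `z² ∈ [0, 1]`,
and the empirical inequalities say that it is positive at both end points. -/
theorem exists_pos_le_g_sub : ∃ l : ℝ, 0 < l ∧ ∀ s, l ≤ P.g s - P.h s ^ 2 / P.γ₁ := by
  have hγ := P.γ₁_pos
  set A : ℝ := (P.α₁ + 2 * P.α₄ + P.α₅ + P.α₆) / 4 with hA
  set D : ℝ := (2 * P.α₄ + P.α₅ + P.α₆ - P.γ₂ ^ 2 / P.γ₁) / 4 with hD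
  have hA0 : 0 < A := by
    have := P.ineq₁
    have := P.α₄_pos
    rw [hA]; linarith
  have hD0 : 0 < D := by
    have h3 := P.ineq₃
    rw [P.parodi, ← P.γ₂_eq] at h3
    have : P.γ₂ ^ 2 / P.γ₁ < 2 * P.α₄ + P.α₅ + P.α₆ := by
      rw [div_lt_iff₀ hγ]; nlinarith
    rw [hD]; linarith
  refine ⟨min A D, lt_min hA0 hD0, fun s => ?_⟩
  have hsc := Real.sin_sq_add_cos_sq s
  set z := Real.cos s ^ 2 - Real.sin s ^ 2 with hz
  have hC : Real.cos s ^ 2 = (1 + z) / 2 := by rw [hz]; linarith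
  have hS : Real.sin s ^ 2 = (1 - z) / 2 := by rw [hz]; linarith
  have hz1 : z ^ 2 ≤ 1 := by
    have := sq_nonneg (Real.cos s); have := sq_nonneg (Real.sin s)
    have h1 : -1 ≤ z := by linarith
    have h2 : z ≤ 1 := by linarith
    nlinarith
  have e2 : P.α₂ = (P.γ₂ - P.γ₁) / 2 := by
    have := P.γ₁_eq; have := P.γ₂_eq; have := P.parodi; linarith
  have e3 : P.α₃ = (P.γ₂ + P.γ₁) / 2 := by
    have := P.γ₁_eq; have := P.γ₂_eq; have := P.parodi; linarith
  have e6 : P.α₆ = P.α₅ + P.γ₂ := by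
    have := P.γ₂_eq; linarith
  have key : P.g s - P.h s ^ 2 / P.γ₁ = A * (1 - z ^ 2) + D * z ^ 2 := by
    unfold g h
    rw [mul_assoc, hC, hS, hA, hD, e2, e3, e6]
    field_simp
    ring
  rw [key]
  have h1 := mul_le_mul_of_nonneg_right (min_le_left A D) (sub_nonneg.2 hz1)
  have h2 := mul_le_mul_of_nonneg_right (min_le_right A D) (sq_nonneg z)
  linarith

theorem g_pos (s : ℝ) : 0 < P.g s := by
  obtain ⟨l, hl, h⟩ := P.exists_pos_le_g_sub
  have := h s
  have := div_nonneg (sq_nonneg (P.h s)) P.γ₁_pos.le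
  linarith

theorem hasDerivAt_m (s : ℝ) : HasDerivAt P.m (P.dm s) s :=
  (P.hasDerivAt_h s).div (P.hasDerivAt_g s) (P.g_pos s).ne'

theorem continuous_m : Continuous P.m :=
  P.continuous_h.div P.continuous_g fun s => (P.g_pos s).ne'

theorem continuous_dm : Continuous P.dm :=
  ((P.continuous_dh.mul P.continuous_g).sub (P.continuous_h.mul P.continuous_dg)).div
    (P.continuous_g.pow 2) fun s => pow_ne_zero _ (P.g_pos s).ne'

theorem g_mul_m (s : ℝ) : P.g s * P.m s = P.h s := mul_div_cancel₀ _ (P.g_pos s).ne'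

end Coeffs

theorem exists_abs_le_of_periodic {f : ℝ → ℝ} (hf : Continuous f)
    (hp : Function.Periodic f (2 * Real.pi)) : ∃ B : ℝ, ∀ s, |f s| ≤ B := by
  obtain ⟨B, hB⟩ := (hp.isBounded_of_continuous (by positivity) hf).exists_norm_le
  exact ⟨B, fun s => hB _ ⟨s, rfl⟩⟩

/-- `lam` is a lower bound for the coercive coefficients and `B` an upper bound for all the
coefficients that occur in the equation for `J`. -/
structure Coeffs.Bounds (P : Coeffs) (lam B : ℝ) : Prop where
  lam_pos : 0 < lam
  one_le : 1 ≤ B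
  coercive : ∀ s, lam ≤ P.g s - P.h s ^ 2 / P.γ₁
  le_g : ∀ s, lam ≤ P.g s
  le_k : ∀ s, lam ≤ P.k s
  abs_g : ∀ s, |P.g s| ≤ B
  abs_h : ∀ s, |P.h s| ≤ B
  abs_k : ∀ s, |P.k s| ≤ B
  abs_dg : ∀ s, |P.dg s| ≤ B
  abs_m : ∀ s, |P.m s| ≤ B
  abs_mk : ∀ s, |P.m s * P.k s| ≤ B
  abs_mh : ∀ s, |P.m s * P.h s| ≤ B
  abs_dm : ∀ s, |P.dm s| ≤ B
  abs_pp : ∀ s, |P.m s * (P.dk s / 2) - (P.dm s * P.k s + P.m s * P.dk s)| ≤ B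
  abs_pu : ∀ s, |P.dm s * P.h s + P.m s * P.dh s| ≤ B
  abs_γm : ∀ s, |P.γ₁ * P.m s| ≤ B

theorem Coeffs.exists_bounds (P : Coeffs) : ∃ lam B : ℝ, P.Bounds lam B := by
  obtain ⟨l1, hl1, h1⟩ := P.exists_pos_le_g_sub
  obtain ⟨l2, hl2, h2⟩ := P.exists_pos_le_k
  have hs : ∀ s, Real.sin (s + 2 * Real.pi) = Real.sin s := Real.sin_add_two_pi
  have hc : ∀ s, Real.cos (s + 2 * Real.pi) = Real.cos s := Real.cos_add_two_pi
  have pg : ∀ s, P.g (s + 2 * Real.pi) = P.g s := fun s => by simp only [Coeffs.g, hs, hc]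
  have ph : ∀ s, P.h (s + 2 * Real.pi) = P.h s := fun s => by simp only [Coeffs.h, hs, hc]
  have pk : ∀ s, P.k (s + 2 * Real.pi) = P.k s := fun s => by simp only [Coeffs.k, hs, hc]
  have pdg : ∀ s, P.dg (s + 2 * Real.pi) = P.dg s := fun s => by simp only [Coeffs.dg, hs, hc]
  have pdh : ∀ s, P.dh (s + 2 * Real.pi) = P.dh s := fun s => by simp only [Coeffs.dh, hs, hc]
  have pdk : ∀ s, P.dk (s + 2 * Real.pi) = P.dk s := fun s => by simp only [Coeffs.dk, hs, hc]
  have pm : ∀ s, P.m (s + 2 * Real.pi) = P.m s := fun s => by simp only [Coeffs.m, pg, ph]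
  have pdm : ∀ s, P.dm (s + 2 * Real.pi) = P.dm s := fun s => by
    simp only [Coeffs.dm, pg, ph, pdg, pdh]
  have cg := P.continuous_g
  have ch := P.continuous_h
  have ck := P.continuous_k
  have cdg := P.continuous_dg
  have cdh := P.continuous_dh
  have cdk := P.continuous_dk
  have cm := P.continuous_m
  have cdm := P.continuous_dm
  obtain ⟨b1, k1⟩ := exists_abs_le_of_periodic cg pg
  obtain ⟨b2, k2⟩ := exists_abs_le_of_periodic ch ph
  obtain ⟨b3, k3⟩ := exists_abs_le_of_periodic ck pk
  obtain ⟨b4, k4⟩ := exists_abs_le_of_periodic cdg pdg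
  obtain ⟨b5, k5⟩ := exists_abs_le_of_periodic cm pm
  obtain ⟨b6, k6⟩ := exists_abs_le_of_periodic (f := fun s => P.m s * P.k s) (by fun_prop)
    (fun s => by simp only [pm, pk])
  obtain ⟨b7, k7⟩ := exists_abs_le_of_periodic (f := fun s => P.m s * P.h s) (by fun_prop)
    (fun s => by simp only [pm, ph])
  obtain ⟨b8, k8⟩ := exists_abs_le_of_periodic cdm pdm
  obtain ⟨b9, k9⟩ := exists_abs_le_of_periodic
    (f := fun s => P.m s * (P.dk s / 2) - (P.dm s * P.k s + P.m s * P.dk s)) (by fun_prop)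
    (fun s => by simp only [pm, pk, pdm, pdk])
  obtain ⟨b10, k10⟩ := exists_abs_le_of_periodic
    (f := fun s => P.dm s * P.h s + P.m s * P.dh s) (by fun_prop)
    (fun s => by simp only [pm, ph, pdm, pdh])
  obtain ⟨b11, k11⟩ := exists_abs_le_of_periodic (f := fun s => P.γ₁ * P.m s) (by fun_prop)
    (fun s => by simp only [pm])
  have n1 := (abs_nonneg _).trans (k1 0)
  have n2 := (abs_nonneg _).trans (k2 0)
  have n3 := (abs_nonneg _).trans (k3 0)
  have n4 := (abs_nonneg _).trans (k4 0)
  have n5 := (abs_nonneg _).trans (k5 0)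
  have n6 := (abs_nonneg _).trans (k6 0)
  have n7 := (abs_nonneg _).trans (k7 0)
  have n8 := (abs_nonneg _).trans (k8 0)
  have n9 := (abs_nonneg _).trans (k9 0)
  have n10 := (abs_nonneg _).trans (k10 0)
  have n11 := (abs_nonneg _).trans (k11 0)
  refine ⟨min l1 l2, 1 + b1 + b2 + b3 + b4 + b5 + b6 + b7 + b8 + b9 + b10 + b11,
    lt_min hl1 hl2, by linarith, fun s => (min_le_left _ _).trans (h1 s), fun s => ?_,
    fun s => (min_le_right _ _).trans (h2 s), fun s => (k1 s).trans (by linarith),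
    fun s => (k2 s).trans (by linarith), fun s => (k3 s).trans (by linarith),
    fun s => (k4 s).trans (by linarith), fun s => (k5 s).trans (by linarith),
    fun s => (k6 s).trans (by linarith), fun s => (k7 s).trans (by linarith),
    fun s => (k8 s).trans (by linarith), fun s => (k9 s).trans (by linarith),
    fun s => (k10 s).trans (by linarith), fun s => (k11 s).trans (by linarith)⟩
  have := (min_le_left _ l2).trans (h1 s)
  have := div_nonneg (sq_nonneg (P.h s)) P.γ₁_pos.le
  linarith

/-! ### Partial derivatives on the strip -/

/-- The closed strip `ℝ × [0, T]`. -/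
abbrev strip (T : ℝ) : Set (ℝ × ℝ) := univ ×ˢ Icc 0 T

theorem uniqueDiffOn_strip {T : ℝ} (hT : 0 < T) : UniqueDiffOn ℝ (strip T) :=
  uniqueDiffOn_univ.prod (uniqueDiffOn_Icc hT)

section Partials

variable {T : ℝ} {f : ℝ → ℝ → ℝ}

theorem hasDerivAt_of_differentiableOn_strip
    (hf : DifferentiableOn ℝ (fun z : ℝ × ℝ => f z.1 z.2) (strip T)) (x : ℝ) {t : ℝ}
    (ht : t ∈ Icc 0 T) :
    HasDerivAt (fun y => f y t)
      (fderivWithin ℝ (fun z : ℝ × ℝ => f z.1 z.2) (strip T) (x, t) (1, 0)) x := by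
  have h1 := (hf (x, t) ⟨mem_univ _, ht⟩).hasFDerivWithinAt
  have h2 : HasDerivAt (fun y : ℝ => (y, t)) ((1 : ℝ), (0 : ℝ)) x :=
    (hasDerivAt_id x).prodMk (hasDerivAt_const x t)
  exact HasFDerivWithinAt.comp_hasDerivAt (f := fun y : ℝ => (y, t)) x h1 h2
    (Eventually.of_forall fun y => ⟨mem_univ _, ht⟩)

theorem hasDerivWithinAt_of_differentiableOn_strip
    (hf : DifferentiableOn ℝ (fun z : ℝ × ℝ => f z.1 z.2) (strip T)) (x : ℝ) {t : ℝ}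
    (ht : t ∈ Icc 0 T) :
    HasDerivWithinAt (fun s => f x s)
      (fderivWithin ℝ (fun z : ℝ × ℝ => f z.1 z.2) (strip T) (x, t) (0, 1)) (Icc 0 T) t := by
  have h1 := (hf (x, t) ⟨mem_univ _, ht⟩).hasFDerivWithinAt
  have h2 : HasDerivWithinAt (fun s : ℝ => (x, s)) ((0 : ℝ), (1 : ℝ)) (Icc 0 T) t :=
    ((hasDerivAt_const t x).prodMk (hasDerivAt_id t)).hasDerivWithinAt
  exact HasFDerivWithinAt.comp_hasDerivWithinAt (f := fun s : ℝ => (x, s)) t h1 h2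
    (fun s hs => ⟨mem_univ _, hs⟩)

theorem ddx_eq_fderivWithin (hf : DifferentiableOn ℝ (fun z : ℝ × ℝ => f z.1 z.2) (strip T))
    (x : ℝ) {t : ℝ} (ht : t ∈ Icc 0 T) :
    ddx f x t = fderivWithin ℝ (fun z : ℝ × ℝ => f z.1 z.2) (strip T) (x, t) (1, 0) :=
  (hasDerivAt_of_differentiableOn_strip hf x ht).deriv

theorem ddt_eq_fderivWithin (hT : 0 < T)
    (hf : DifferentiableOn ℝ (fun z : ℝ × ℝ => f z.1 z.2) (strip T))
    (x : ℝ) {t : ℝ} (ht : t ∈ Icc 0 T) :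
    ddt T f x t = fderivWithin ℝ (fun z : ℝ × ℝ => f z.1 z.2) (strip T) (x, t) (0, 1) :=
  (hasDerivWithinAt_of_differentiableOn_strip hf x ht).derivWithin (uniqueDiffOn_Icc hT t ht)

theorem hasDerivAt_ddx (hf : DifferentiableOn ℝ (fun z : ℝ × ℝ => f z.1 z.2) (strip T))
    (x : ℝ) {t : ℝ} (ht : t ∈ Icc 0 T) : HasDerivAt (fun y => f y t) (ddx f x t) x := by
  rw [ddx_eq_fderivWithin hf x ht]
  exact hasDerivAt_of_differentiableOn_strip hf x ht

theorem hasDerivAt_ddt (hT : 0 < T)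
    (hf : DifferentiableOn ℝ (fun z : ℝ × ℝ => f z.1 z.2) (strip T))
    (x : ℝ) {t : ℝ} (ht : t ∈ Ioo 0 T) : HasDerivAt (fun s => f x s) (ddt T f x t) t := by
  rw [ddt_eq_fderivWithin hT hf x (Ioo_subset_Icc_self ht)]
  exact (hasDerivWithinAt_of_differentiableOn_strip hf x (Ioo_subset_Icc_self ht)).hasDerivAt
    (Icc_mem_nhds ht.1 ht.2)

theorem contDiffOn_ddx {n : ℕ} (hT : 0 < T)
    (hf : ContDiffOn ℝ (n + 1 : ℕ) (fun z : ℝ × ℝ => f z.1 z.2) (strip T)) :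
    ContDiffOn ℝ n (fun z : ℝ × ℝ => ddx f z.1 z.2) (strip T) := by
  have h1 := hf.fderivWithin (m := n) (uniqueDiffOn_strip hT) (by norm_cast)
  exact (h1.clm_apply contDiffOn_const).congr fun z hz =>
    ddx_eq_fderivWithin (hf.differentiableOn (by simp)) z.1 hz.2

theorem contDiffOn_ddt {n : ℕ} (hT : 0 < T)
    (hf : ContDiffOn ℝ (n + 1 : ℕ) (fun z : ℝ × ℝ => f z.1 z.2) (strip T)) :
    ContDiffOn ℝ n (fun z : ℝ × ℝ => ddt T f z.1 z.2) (strip T) := by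
  have h1 := hf.fderivWithin (m := n) (uniqueDiffOn_strip hT) (by norm_cast)
  exact (h1.clm_apply contDiffOn_const).congr fun z hz =>
    ddt_eq_fderivWithin hT (hf.differentiableOn (by simp)) z.1 hz.2

theorem ddt_ddx_comm (hT : 0 < T)
    (hf : ContDiffOn ℝ 2 (fun z : ℝ × ℝ => f z.1 z.2) (strip T)) (x : ℝ) {t : ℝ}
    (ht : t ∈ Icc 0 T) : ddt T (ddx f) x t = ddx (ddt T f) x t := by
  have hU := uniqueDiffOn_strip hT
  have hz : (x, t) ∈ strip T := ⟨mem_univ _, ht⟩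
  have hd := hf.differentiableOn (by norm_num)
  have hf' : ContDiffOn ℝ (1 + 1 : ℕ) (fun z : ℝ × ℝ => f z.1 z.2) (strip T) := hf
  have hx := (contDiffOn_ddx hT hf').differentiableOn (by norm_num)
  have ht' := (contDiffOn_ddt hT hf').differentiableOn (by norm_num)
  have hD : DifferentiableWithinAt ℝ (fderivWithin ℝ (fun z : ℝ × ℝ => f z.1 z.2) (strip T))
      (strip T) (x, t) :=
    (hf.fderivWithin (m := 1) hU (by norm_num)).differentiableOn (by norm_num) _ hz
  have key : ∀ v : ℝ × ℝ, fderivWithin ℝ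
      (fun z => fderivWithin ℝ (fun z : ℝ × ℝ => f z.1 z.2) (strip T) z v) (strip T) (x, t) =
      (fderivWithin ℝ (fderivWithin ℝ (fun z : ℝ × ℝ => f z.1 z.2) (strip T))
        (strip T) (x, t)).flip v := fun v => by
    have := hD.hasFDerivWithinAt.clm_apply (hasFDerivWithinAt_const v (x, t) (strip T))
    rw [this.fderivWithin (hU _ hz)]
    ext <;> simp
  have hS : IsSymmSndFDerivWithinAt ℝ (fun z : ℝ × ℝ => f z.1 z.2) (strip T) (x, t) := by
    refine (hf _ hz).isSymmSndFDerivWithinAt (by simp) hU ?_ hz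
    have : interior (strip T) = univ ×ˢ Ioo 0 T := by
      rw [interior_prod_eq, interior_univ, interior_Icc]
    rw [this, closure_prod_eq, closure_univ, closure_Ioo hT.ne]
    exact hz
  have e1 := (fderivWithin_congr (fun z hz => ddx_eq_fderivWithin hd z.1 hz.2)
    (ddx_eq_fderivWithin hd x ht)).trans (key (1, 0))
  have e2 := (fderivWithin_congr (fun z hz => ddt_eq_fderivWithin hT hd z.1 hz.2)
    (ddt_eq_fderivWithin hT hd x ht)).trans (key (0, 1))
  rw [ddt_eq_fderivWithin hT hx x ht, ddx_eq_fderivWithin ht' x ht, e1, e2]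
  exact hS _ _

end Partials

/-- A classical solution together with its derivatives, as continuous functions on the whole plane:
`p = θ_x`, `q = θ_t`, `a = θ_xx`, `b = θ_xt`, `r = θ_tt`, `v = u_x`, `w = u_t`, `z = u_xt`. Time
derivatives are only required inside `(0, T)`, so that functions on the strip can be extended constantly in time.
The wave equation is written with `k = c²`. -/
structure Flow (P : Coeffs) (T : ℝ) where
  (th p q a b r u v w z : ℝ → ℝ → ℝ)
  cont_th : Continuous fun z : ℝ × ℝ => th z.1 z.2
  cont_p : Continuous fun z : ℝ × ℝ => p z.1 z.2
  cont_q : Continuous fun z : ℝ × ℝ => q z.1 z.2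
  cont_a : Continuous fun z : ℝ × ℝ => a z.1 z.2
  cont_b : Continuous fun z : ℝ × ℝ => b z.1 z.2
  cont_r : Continuous fun z : ℝ × ℝ => r z.1 z.2
  cont_u : Continuous fun z : ℝ × ℝ => u z.1 z.2
  cont_v : Continuous fun z : ℝ × ℝ => v z.1 z.2
  cont_w : Continuous fun z : ℝ × ℝ => w z.1 z.2
  cont_z : Continuous fun y : ℝ × ℝ => z y.1 y.2
  th_x : ∀ x t, HasDerivAt (fun y => th y t) (p x t) x
  p_x : ∀ x t, HasDerivAt (fun y => p y t) (a x t) x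
  q_x : ∀ x t, HasDerivAt (fun y => q y t) (b x t) x
  u_x : ∀ x t, HasDerivAt (fun y => u y t) (v x t) x
  w_x : ∀ x t, HasDerivAt (fun y => w y t) (z x t) x
  th_t : ∀ x, ∀ t ∈ Ioo 0 T, HasDerivAt (fun s => th x s) (q x t) t
  p_t : ∀ x, ∀ t ∈ Ioo 0 T, HasDerivAt (fun s => p x s) (b x t) t
  q_t : ∀ x, ∀ t ∈ Ioo 0 T, HasDerivAt (fun s => q x s) (r x t) t
  u_t : ∀ x, ∀ t ∈ Ioo 0 T, HasDerivAt (fun s => u x s) (w x t) t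
  v_t : ∀ x, ∀ t ∈ Ioo 0 T, HasDerivAt (fun s => v x s) (z x t) t
  heat : ∀ x t, HasDerivAt (fun y => P.g (th y t) * v y t + P.h (th y t) * q y t) (w x t) x
  wave : ∀ x t, r x t = P.dk (th x t) / 2 * p x t ^ 2 + P.k (th x t) * a x t
    - P.γ₁ * q x t - P.h (th x t) * v x t

/-- The projection of the time axis onto `[0, T]`. -/
def clamp (T t : ℝ) : ℝ := max 0 (min t T)

theorem continuous_clamp (T : ℝ) : Continuous (clamp T) := by unfold clamp; fun_prop

theorem clamp_mem {T : ℝ} (hT : 0 < T) (t : ℝ) : clamp T t ∈ Icc 0 T :=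
  ⟨le_max_left _ _, max_le hT.le (min_le_right _ _)⟩

theorem clamp_of_mem {T t : ℝ} (ht : t ∈ Icc 0 T) : clamp T t = t := by
  rw [clamp, min_eq_left ht.2, max_eq_right ht.1]

theorem continuous_clamped {T : ℝ} (hT : 0 < T) {f : ℝ → ℝ → ℝ}
    (hf : ContinuousOn (fun z : ℝ × ℝ => f z.1 z.2) (strip T)) :
    Continuous fun z : ℝ × ℝ => f z.1 (clamp T z.2) := by
  have h1 : Continuous fun z : ℝ × ℝ => (z.1, clamp T z.2) :=
    continuous_fst.prodMk ((continuous_clamp T).comp continuous_snd)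
  exact hf.comp_continuous h1 fun z => ⟨mem_univ _, clamp_mem hT z.2⟩

theorem hasDerivAt_clamped {T : ℝ} (hT : 0 < T) {f : ℝ → ℝ → ℝ}
    (hf : DifferentiableOn ℝ (fun z : ℝ × ℝ => f z.1 z.2) (strip T)) (x : ℝ) {t : ℝ}
    (ht : t ∈ Ioo 0 T) :
    HasDerivAt (fun s => f x (clamp T s)) (ddt T f x (clamp T t)) t := by
  rw [clamp_of_mem (Ioo_subset_Icc_self ht)]
  refine (hasDerivAt_ddt hT hf x ht).congr_of_eventuallyEq ?_
  filter_upwards [Icc_mem_nhds ht.1 ht.2] with s hs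
  rw [clamp_of_mem hs]

/-- The flow of a classical solution. -/
def IsSolution.flow {P : Coeffs} {T : ℝ} {θ u : ℝ → ℝ → ℝ} (hT : 0 < T)
    (hS : IsSolution P T θ u) : Flow P T :=
  have hθ : ContDiffOn ℝ (1 + 1 : ℕ) (fun z : ℝ × ℝ => θ z.1 z.2) (strip T) := hS.smooth_θ
  have hu : ContDiffOn ℝ (1 + 1 : ℕ) (fun z : ℝ × ℝ => u z.1 z.2) (strip T) := hS.smooth_u
  have hp : ContDiffOn ℝ (0 + 1 : ℕ) (fun z : ℝ × ℝ => ddx θ z.1 z.2) (strip T) :=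
    contDiffOn_ddx hT hθ
  have hq : ContDiffOn ℝ (0 + 1 : ℕ) (fun z : ℝ × ℝ => ddt T θ z.1 z.2) (strip T) :=
    contDiffOn_ddt hT hθ
  have hv : ContDiffOn ℝ (0 + 1 : ℕ) (fun z : ℝ × ℝ => ddx u z.1 z.2) (strip T) :=
    contDiffOn_ddx hT hu
  have hw : ContDiffOn ℝ (0 + 1 : ℕ) (fun z : ℝ × ℝ => ddt T u z.1 z.2) (strip T) :=
    contDiffOn_ddt hT hu
  have dθ := hθ.differentiableOn (by simp)
  have du := hu.differentiableOn (by simp)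
  have dp := hp.differentiableOn (by simp)
  have dq := hq.differentiableOn (by simp)
  have dv := hv.differentiableOn (by simp)
  have dw := hw.differentiableOn (by simp)
  { th := fun x t => θ x (clamp T t)
    p := fun x t => ddx θ x (clamp T t)
    q := fun x t => ddt T θ x (clamp T t)
    a := fun x t => ddx (ddx θ) x (clamp T t)
    b := fun x t => ddx (ddt T θ) x (clamp T t)
    r := fun x t => ddt T (ddt T θ) x (clamp T t)
    u := fun x t => u x (clamp T t)
    v := fun x t => ddx u x (clamp T t)
    w := fun x t => ddt T u x (clamp T t)
    z := fun x t => ddx (ddt T u) x (clamp T t)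
    cont_th := continuous_clamped hT hθ.continuousOn
    cont_p := continuous_clamped hT hp.continuousOn
    cont_q := continuous_clamped hT hq.continuousOn
    cont_a := continuous_clamped hT (contDiffOn_ddx hT hp).continuousOn
    cont_b := continuous_clamped hT (contDiffOn_ddx hT hq).continuousOn
    cont_r := continuous_clamped hT (contDiffOn_ddt hT hq).continuousOn
    cont_u := continuous_clamped hT hu.continuousOn
    cont_v := continuous_clamped hT hv.continuousOn
    cont_w := continuous_clamped hT (contDiffOn_ddt hT hu).continuousOn
    cont_z := continuous_clamped hT (contDiffOn_ddx hT hw).continuousOn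
    th_x := fun x t => hasDerivAt_ddx dθ x (clamp_mem hT t)
    p_x := fun x t => hasDerivAt_ddx dp x (clamp_mem hT t)
    q_x := fun x t => hasDerivAt_ddx dq x (clamp_mem hT t)
    u_x := fun x t => hasDerivAt_ddx du x (clamp_mem hT t)
    w_x := fun x t => hasDerivAt_ddx dw x (clamp_mem hT t)
    th_t := fun x t ht => hasDerivAt_clamped hT dθ x ht
    p_t := fun x t ht => by
      rw [← ddt_ddx_comm hT hS.smooth_θ x (clamp_mem hT t)]
      exact hasDerivAt_clamped hT dp x ht
    q_t := fun x t ht => hasDerivAt_clamped hT dq x ht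
    u_t := fun x t ht => hasDerivAt_clamped hT du x ht
    v_t := fun x t ht => by
      rw [← ddt_ddx_comm hT hS.smooth_u x (clamp_mem hT t)]
      exact hasDerivAt_clamped hT dv x ht
    heat := fun x t => by
      have hm := clamp_mem hT t
      rw [hS.heat x _ hm]
      have h1 := (P.hasDerivAt_g _).comp x (hasDerivAt_ddx dθ x hm)
      have h2 := (P.hasDerivAt_h _).comp x (hasDerivAt_ddx dθ x hm)
      have h3 := (h1.mul (hasDerivAt_ddx dv x hm)).add (h2.mul (hasDerivAt_ddx dq x hm))
      exact h3.differentiableAt.hasDerivAt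
    wave := fun x t => by
      have hm := clamp_mem hT t
      have h0 := hS.wave x _ hm
      have h1 := (P.hasDerivAt_c _).comp x (hasDerivAt_ddx dθ x hm)
      have h2 : ddx (fun y s => P.c (θ y s) * ddx θ y s) x (clamp T t) = _ :=
        (h1.mul (hasDerivAt_ddx dp x hm)).deriv
      rw [h2] at h0
      have hc := (P.c_pos (θ x (clamp T t))).ne'
      rw [eq_sub_iff_add_eq, eq_sub_iff_add_eq]
      simp only [Function.comp] at h0
      rw [← P.c_sq]
      field_simp at h0 ⊢
      linarith }

/-! ### Integration over rectangles and the energy inequality -/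

section Rectangles

theorem continuous_slice_left {f : ℝ → ℝ → ℝ} (hf : Continuous fun z : ℝ × ℝ => f z.1 z.2)
    (t : ℝ) : Continuous fun x => f x t :=
  hf.comp (continuous_id.prodMk continuous_const)

theorem continuous_slice_right {f : ℝ → ℝ → ℝ} (hf : Continuous fun z : ℝ × ℝ => f z.1 z.2)
    (x : ℝ) : Continuous fun t => f x t :=
  hf.comp (continuous_const.prodMk continuous_id)

theorem continuous_integral_slice {f : ℝ → ℝ → ℝ}
    (hf : Continuous fun z : ℝ × ℝ => f z.1 z.2) (a b : ℝ) :
    Continuous fun t => ∫ x in a..b, f x t :=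
  intervalIntegral.continuous_parametric_intervalIntegral_of_continuous'
    (f := fun t x => f x t) (hf.comp continuous_swap) a b

theorem integral_sub_eq_integral_time_deriv {f f' : ℝ → ℝ → ℝ}
    (hf : Continuous fun z : ℝ × ℝ => f z.1 z.2)
    (hf' : Continuous fun z : ℝ × ℝ => f' z.1 z.2) {a b t₁ : ℝ} (hab : a ≤ b) (ht : 0 ≤ t₁)
    (h : ∀ x, ∀ t ∈ Ioo 0 t₁, HasDerivAt (fun s => f x s) (f' x t) t) :
    (∫ x in a..b, f x t₁) - ∫ x in a..b, f x 0 = ∫ t in (0)..t₁, ∫ x in a..b, f' x t := by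
  have h1 : ∀ x, ∫ t in (0)..t₁, f' x t = f x t₁ - f x 0 := fun x =>
    intervalIntegral.integral_eq_sub_of_hasDerivAt_of_le ht
      (continuous_slice_right hf x).continuousOn (h x)
      ((continuous_slice_right hf' x).intervalIntegrable _ _)
  rw [← intervalIntegral.integral_sub ((continuous_slice_left hf t₁).intervalIntegrable _ _)
    ((continuous_slice_left hf 0).intervalIntegrable _ _)]
  simp_rw [← h1]
  simp only [intervalIntegral.integral_of_le hab, intervalIntegral.integral_of_le ht]
  refine integral_integral_swap ?_
  rw [Measure.prod_restrict]
  exact (hf'.continuousOn.integrableOn_compact (isCompact_Icc.prod isCompact_Icc)).mono_set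
    (prod_mono Ioc_subset_Icc_self Ioc_subset_Icc_self)

/-- The Cauchy–Schwarz inequality on an interval. -/
theorem abs_integral_mul_le {f g : ℝ → ℝ} (hf : Continuous f) (hg : Continuous g) {a b : ℝ}
    (hab : a ≤ b) : ∫ x in a..b, |f x| * |g x| ≤
      √(∫ x in a..b, f x ^ 2) * √(∫ x in a..b, g x ^ 2) := by
  have i1 : IntervalIntegrable (fun x => f x ^ 2) volume a b := by
    apply Continuous.intervalIntegrable; fun_prop
  have i2 : IntervalIntegrable (fun x => g x ^ 2) volume a b := by
    apply Continuous.intervalIntegrable; fun_prop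
  have i3 : IntervalIntegrable (fun x => |f x| * |g x|) volume a b := by
    apply Continuous.intervalIntegrable; fun_prop
  set X := ∫ x in a..b, f x ^ 2
  set Y := ∫ x in a..b, g x ^ 2
  set Z := ∫ x in a..b, |f x| * |g x|
  have hX : 0 ≤ X := intervalIntegral.integral_nonneg hab fun x _ => sq_nonneg _
  have hY : 0 ≤ Y := intervalIntegral.integral_nonneg hab fun x _ => sq_nonneg _
  have key : ∀ s : ℝ, 0 ≤ X * (s * s) + (-2 * Z) * s + Y := fun s => by
    have h0 : 0 ≤ ∫ x in a..b, (s * |f x| - |g x|) ^ 2 :=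
      intervalIntegral.integral_nonneg hab fun x _ => sq_nonneg _
    have h1 : (fun x => (s * |f x| - |g x|) ^ 2) =
        fun x => s * s * f x ^ 2 - 2 * s * (|f x| * |g x|) + g x ^ 2 := by
      funext x
      rw [← sq_abs (f x), ← sq_abs (g x)]
      ring
    rw [h1, intervalIntegral.integral_add ((i1.const_mul _).sub (i3.const_mul _)) i2,
      intervalIntegral.integral_sub (i1.const_mul _) (i3.const_mul _),
      intervalIntegral.integral_const_mul, intervalIntegral.integral_const_mul] at h0
    linarith
  have h2 := discrim_le_zero key
  rw [discrim] at h2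
  rw [← Real.sqrt_mul hX]
  exact Real.le_sqrt_of_sq_le (by linarith)

end Rectangles

namespace Flow

variable {P : Coeffs} {T : ℝ} (F : Flow P T)

/-- Twice the energy density. -/
def e (x t : ℝ) : ℝ := F.q x t ^ 2 + P.k (F.th x t) * F.p x t ^ 2 + F.u x t ^ 2

/-- The viscous stress `g u_x + h θ_t = g J`. -/
def S (x t : ℝ) : ℝ := P.g (F.th x t) * F.v x t + P.h (F.th x t) * F.q x t

theorem cont_g : Continuous fun z : ℝ × ℝ => P.g (F.th z.1 z.2) := P.continuous_g.comp F.cont_th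
theorem cont_h : Continuous fun z : ℝ × ℝ => P.h (F.th z.1 z.2) := P.continuous_h.comp F.cont_th
theorem cont_k : Continuous fun z : ℝ × ℝ => P.k (F.th z.1 z.2) := P.continuous_k.comp F.cont_th
theorem cont_m : Continuous fun z : ℝ × ℝ => P.m (F.th z.1 z.2) := P.continuous_m.comp F.cont_th
theorem cont_dh : Continuous fun z : ℝ × ℝ => P.dh (F.th z.1 z.2) :=
  P.continuous_dh.comp F.cont_th
theorem cont_dk : Continuous fun z : ℝ × ℝ => P.dk (F.th z.1 z.2) :=
  P.continuous_dk.comp F.cont_th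
theorem cont_dm : Continuous fun z : ℝ × ℝ => P.dm (F.th z.1 z.2) :=
  P.continuous_dm.comp F.cont_th

theorem cont_S : Continuous fun z : ℝ × ℝ => F.S z.1 z.2 :=
  (F.cont_g.mul F.cont_v).add (F.cont_h.mul F.cont_q)

theorem cont_e : Continuous fun z : ℝ × ℝ => F.e z.1 z.2 :=
  ((F.cont_q.pow 2).add (F.cont_k.mul (F.cont_p.pow 2))).add (F.cont_u.pow 2)

theorem e_nonneg (x t : ℝ) : 0 ≤ F.e x t := by
  have := P.k_pos (F.th x t)
  unfold e
  positivity

theorem k_mul_sq_le_e (x t : ℝ) : P.k (F.th x t) * F.p x t ^ 2 ≤ F.e x t := by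
  unfold e
  nlinarith [sq_nonneg (F.q x t), sq_nonneg (F.u x t)]

theorem q_sq_le_e (x t : ℝ) : F.q x t ^ 2 ≤ F.e x t := by
  have := mul_nonneg (P.k_pos (F.th x t)).le (sq_nonneg (F.p x t))
  unfold e
  nlinarith [sq_nonneg (F.u x t)]

theorem u_sq_le_e (x t : ℝ) : F.u x t ^ 2 ≤ F.e x t := by
  have := mul_nonneg (P.k_pos (F.th x t)).le (sq_nonneg (F.p x t))
  unfold e
  nlinarith [sq_nonneg (F.q x t)]

/-- The energy flux `c² θ_x θ_t + u S`. -/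
def flux (x t : ℝ) : ℝ := P.k (F.th x t) * F.p x t * F.q x t + F.u x t * F.S x t

/-- The space derivative of the energy flux. -/
def dflux (x t : ℝ) : ℝ :=
  (P.dk (F.th x t) * F.p x t * F.p x t + P.k (F.th x t) * F.a x t) * F.q x t
    + P.k (F.th x t) * F.p x t * F.b x t + (F.v x t * F.S x t + F.u x t * F.w x t)

theorem hasDerivAt_flux (x t : ℝ) : HasDerivAt (fun y => F.flux y t) (F.dflux x t) x :=
  ((((P.hasDerivAt_k _).comp x (F.th_x x t)).mul (F.p_x x t)).mul (F.q_x x t)).add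
    ((F.u_x x t).mul (F.heat x t))

theorem cont_flux : Continuous fun z : ℝ × ℝ => F.flux z.1 z.2 :=
  ((F.cont_k.mul F.cont_p).mul F.cont_q).add (F.cont_u.mul F.cont_S)

theorem cont_dflux : Continuous fun z : ℝ × ℝ => F.dflux z.1 z.2 :=
  (((((F.cont_dk.mul F.cont_p).mul F.cont_p).add (F.cont_k.mul F.cont_a)).mul F.cont_q).add
    ((F.cont_k.mul F.cont_p).mul F.cont_b)).add
      ((F.cont_v.mul F.cont_S).add (F.cont_u.mul F.cont_w))

/-- The rate of dissipation of the energy. -/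
def diss (x t : ℝ) : ℝ :=
  P.γ₁ * F.q x t ^ 2 + 2 * P.h (F.th x t) * F.q x t * F.v x t
    + P.g (F.th x t) * F.v x t ^ 2

theorem cont_diss : Continuous fun z : ℝ × ℝ => F.diss z.1 z.2 :=
  (((continuous_const.mul (F.cont_q.pow 2)).add
    (((continuous_const.mul F.cont_h).mul F.cont_q).mul F.cont_v)).add
      (F.cont_g.mul (F.cont_v.pow 2)))

/-- The local energy identity. -/
theorem hasDerivAt_e (x : ℝ) {t : ℝ} (ht : t ∈ Ioo 0 T) :
    HasDerivAt (fun s => F.e x s) (2 * (F.dflux x t - F.diss x t)) t := by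
  have h1 := (((F.q_t x t ht).pow 2).add
    (((P.hasDerivAt_k _).comp t (F.th_t x t ht)).mul ((F.p_t x t ht).pow 2))).add
      ((F.u_t x t ht).pow 2)
  refine h1.congr_deriv ?_
  simp only [Function.comp, Pi.pow_apply]
  rw [F.wave]
  unfold dflux diss S
  push_cast
  ring

end Flow

theorem coercive_of_le {γ g h lam q v : ℝ} (hγ : 0 < γ) (H : lam ≤ g - h ^ 2 / γ) :
    lam * v ^ 2 ≤ γ * q ^ 2 + 2 * h * q * v + g * v ^ 2 := by
  have h1 : γ * q ^ 2 + 2 * h * q * v + h ^ 2 / γ * v ^ 2 = γ * (q + h * v / γ) ^ 2 := by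
    field_simp
    ring
  have h2 : 0 ≤ γ * (q + h * v / γ) ^ 2 := by positivity
  nlinarith [mul_le_mul_of_nonneg_right H (sq_nonneg v)]

/-- The flux through the flanks of a cutoff `ψ²` is absorbed by the dissipation, up to a multiple of
the energy density that is small with the slope of `ψ`. -/
theorem flux_absorbed {k p q u g v h lam B ψ η ε D e : ℝ} (hlam : 0 < lam) (hB : 1 ≤ B)
    (hk : 0 ≤ k) (hkB : k ≤ B) (hgB : |g| ≤ B) (hhB : |h| ≤ B)
    (hψ : 0 ≤ ψ) (hψ1 : ψ ≤ 1) (hη : |η| ≤ 2 * ε) (hε : 0 ≤ ε) (hε1 : ε ≤ 1)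
    (hD : lam * v ^ 2 ≤ D) (he : e = q ^ 2 + k * p ^ 2 + u ^ 2) :
    -(2 * ψ * η) * (k * p * q + u * (g * v + h * q)) - ψ ^ 2 * D ≤
      ε * ((8 * B + 8 * B ^ 2 / lam) * e) - lam / 2 * (ψ ^ 2 * v ^ 2) := by
  have hB0 : 0 ≤ B := by linarith
  have hkp : 0 ≤ k * p ^ 2 := mul_nonneg hk (sq_nonneg p)
  have e1 : q ^ 2 ≤ e := by nlinarith [sq_nonneg u]
  have e2 : k * p ^ 2 ≤ e := by nlinarith [sq_nonneg u, sq_nonneg q]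
  have e3 : u ^ 2 ≤ e := by nlinarith [sq_nonneg q]
  have e0 : 0 ≤ e := (sq_nonneg u).trans e3
  have hψη : |2 * ψ * η| ≤ 4 * ε := by
    rw [abs_mul, abs_of_nonneg (by positivity : 0 ≤ 2 * ψ)]
    nlinarith [mul_le_mul hψ1 hη (abs_nonneg η) zero_le_one]
  have a1 : |k * p * q| ≤ B * e := by
    rw [abs_le]
    have h1 : k * q ^ 2 ≤ B * e := mul_le_mul hkB e1 (sq_nonneg q) hB0
    have h2 : e ≤ B * e := by nlinarith
    have := mul_nonneg hk (sq_nonneg (p + q))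
    have := mul_nonneg hk (sq_nonneg (p - q))
    constructor <;> nlinarith
  have a2 : |u * (h * q)| ≤ B * e := by
    have h3 : |u| * |q| ≤ e := by
      have := two_mul_le_add_sq |u| |q|
      rw [sq_abs, sq_abs] at this
      nlinarith
    rw [abs_mul, abs_mul]
    calc |u| * (|h| * |q|) = |h| * (|u| * |q|) := by ring
      _ ≤ B * e := mul_le_mul hhB h3 (by positivity) hB0
  have b1 : -(2 * ψ * η) * (k * p * q + u * (h * q)) ≤ 4 * ε * (2 * (B * e)) := by
    refine (le_abs_self _).trans ?_
    rw [abs_mul, abs_neg]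
    refine mul_le_mul hψη ?_ (abs_nonneg _) (by positivity)
    exact (abs_add_le _ _).trans (by linarith)
  have b2 : -(2 * ψ * η) * (u * (g * v)) ≤
      lam / 2 * (ψ ^ 2 * v ^ 2) + ε * (8 * B ^ 2 / lam * e) := by
    have h1 : -(2 * ψ * η) * (u * (g * v)) ≤ (4 * ε * B * |u|) * (ψ * |v|) := by
      refine (le_abs_self _).trans ?_
      rw [abs_mul, abs_neg, abs_mul (2 * ψ), abs_mul u, abs_mul g,
        abs_of_nonneg (by positivity : 0 ≤ 2 * ψ)]
      have : |η| * |g| ≤ 2 * ε * B := mul_le_mul hη hgB (abs_nonneg _) (by positivity)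
      calc 2 * ψ * |η| * (|u| * (|g| * |v|)) = (|η| * |g|) * (2 * ψ * |u| * |v|) := by ring
        _ ≤ (2 * ε * B) * (2 * ψ * |u| * |v|) :=
          mul_le_mul_of_nonneg_right this (by positivity)
        _ = _ := by ring
    have h2 : (4 * ε * B * |u|) * (ψ * |v|) ≤
        lam / 2 * (ψ ^ 2 * v ^ 2) + ε ^ 2 * (8 * B ^ 2 / lam * u ^ 2) := by
      have h3 : 0 ≤ lam / 2 * (ψ * |v| - 4 * ε * B * |u| / lam) ^ 2 := by positivity
      have h4 : lam / 2 * (ψ * |v| - 4 * ε * B * |u| / lam) ^ 2 =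
          lam / 2 * (ψ ^ 2 * |v| ^ 2) + ε ^ 2 * (8 * B ^ 2 / lam * |u| ^ 2)
            - (4 * ε * B * |u|) * (ψ * |v|) := by
        field_simp
        ring
      rw [sq_abs, sq_abs] at h4
      linarith
    have h5 : ε ^ 2 * (8 * B ^ 2 / lam * u ^ 2) ≤ ε * (8 * B ^ 2 / lam * e) := by
      have : ε ^ 2 ≤ ε := by nlinarith
      gcongr
    linarith
  have b3 : ψ ^ 2 * (lam * v ^ 2) ≤ ψ ^ 2 * D := mul_le_mul_of_nonneg_left hD (sq_nonneg ψ)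
  have split : -(2 * ψ * η) * (k * p * q + u * (g * v + h * q)) =
      -(2 * ψ * η) * (k * p * q + u * (h * q)) + -(2 * ψ * η) * (u * (g * v)) := by ring
  rw [split]
  linarith

namespace Flow

variable {P : Coeffs} {T : ℝ} (F : Flow P T)

/-- The energy inequality localised by the cutoff `(1 - ((x - x₀) / R)²)²`. -/
theorem weighted_energy_le {lam B : ℝ} (hb : P.Bounds lam B) (x₀ : ℝ) {R : ℝ} (hR : 1 ≤ R)
    {t₁ : ℝ} (ht₁ : t₁ ∈ Icc 0 T) :
    (∫ x in (x₀ - R)..(x₀ + R), (1 - ((x - x₀) / R) ^ 2) ^ 2 * F.e x t₁) / 2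
      + lam / 2 * ∫ t in (0)..t₁, ∫ x in (x₀ - R)..(x₀ + R),
        (1 - ((x - x₀) / R) ^ 2) ^ 2 * F.v x t ^ 2
      ≤ (∫ x in (x₀ - R)..(x₀ + R), (1 - ((x - x₀) / R) ^ 2) ^ 2 * F.e x 0) / 2
      + (8 * B + 8 * B ^ 2 / lam) / R *
        ∫ t in (0)..t₁, ∫ x in (x₀ - R)..(x₀ + R), F.e x t := by
  have hR0 : 0 < R := by linarith
  set ψ : ℝ → ℝ := fun x => 1 - ((x - x₀) / R) ^ 2 with hψ
  set dψ : ℝ → ℝ := fun x => -(2 * (x - x₀) / R ^ 2) with hdψ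
  have hab : x₀ - R ≤ x₀ + R := by linarith
  have cψ : Continuous ψ := by rw [hψ]; fun_prop
  have cdψ : Continuous dψ := by rw [hdψ]; fun_prop
  have hψd : ∀ x, HasDerivAt ψ (dψ x) x := fun x => by
    have := ((((hasDerivAt_id x).sub_const x₀).div_const R).pow 2).const_sub 1
    refine this.congr_deriv ?_
    simp only [id, hdψ]
    push_cast
    field_simp
  have cψ' : Continuous fun z : ℝ × ℝ => ψ z.1 := cψ.comp continuous_fst
  have cdψ' : Continuous fun z : ℝ × ℝ => dψ z.1 := cdψ.comp continuous_fst
  have ce := F.cont_e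
  have cdf := F.cont_dflux
  have cf := F.cont_flux
  have cd := F.cont_diss
  have cv := F.cont_v
  have h1 := integral_sub_eq_integral_time_deriv (f := fun x t => ψ x ^ 2 * F.e x t / 2)
    (f' := fun x t => ψ x ^ 2 * (F.dflux x t - F.diss x t)) (by fun_prop) (by fun_prop) hab
    ht₁.1 fun x t ht => by
      have := ((F.hasDerivAt_e x ⟨ht.1, ht.2.trans_le ht₁.2⟩).const_mul (ψ x ^ 2)).div_const 2
      exact this.congr_deriv (by ring)
  -- space integration by parts: the weight vanishes at both ends
  have h2 : ∀ t, ∫ x in (x₀ - R)..(x₀ + R), ψ x ^ 2 * (F.dflux x t - F.diss x t) =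
      ∫ x in (x₀ - R)..(x₀ + R),
        (-(2 * ψ x * dψ x) * F.flux x t - ψ x ^ 2 * F.diss x t) := fun t => by
    have s1 := continuous_slice_left cdf t
    have s2 := continuous_slice_left cd t
    have s3 := continuous_slice_left cf t
    have h3 : ∫ x in (x₀ - R)..(x₀ + R),
        (2 * ψ x * dψ x * F.flux x t + ψ x ^ 2 * F.dflux x t) = 0 := by
      rw [intervalIntegral.integral_eq_sub_of_hasDerivAt
        (f := fun x => ψ x ^ 2 * F.flux x t)]
      · have e1 : ψ (x₀ + R) = 0 := by simp [hψ, hR0.ne']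
        have e2 : ψ (x₀ - R) = 0 := by simp [hψ, hR0.ne']
        rw [e1, e2]; ring
      · intro x _
        have := ((hψd x).pow 2).mul (F.hasDerivAt_flux x t)
        refine this.congr_deriv ?_
        simp only [Pi.pow_apply]
        push_cast
        ring
      · apply Continuous.intervalIntegrable; fun_prop
    rw [← sub_eq_zero, ← intervalIntegral.integral_sub, ← h3]
    · congr 1; funext x; ring
    · apply Continuous.intervalIntegrable; fun_prop
    · apply Continuous.intervalIntegrable; fun_prop
  have h4 : ∀ t, ∫ x in (x₀ - R)..(x₀ + R), ψ x ^ 2 * (F.dflux x t - F.diss x t) ≤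
      (8 * B + 8 * B ^ 2 / lam) / R * (∫ x in (x₀ - R)..(x₀ + R), F.e x t)
        - lam / 2 * ∫ x in (x₀ - R)..(x₀ + R), ψ x ^ 2 * F.v x t ^ 2 := fun t => by
    have s1 := continuous_slice_left ce t
    have s2 := continuous_slice_left cd t
    have s3 := continuous_slice_left cf t
    have s4 := continuous_slice_left cv t
    rw [h2, ← intervalIntegral.integral_const_mul, ← intervalIntegral.integral_const_mul,
      ← intervalIntegral.integral_sub]
    · apply intervalIntegral.integral_mono_on hab
      · apply Continuous.intervalIntegrable; fun_prop
      · apply Continuous.intervalIntegrable; fun_prop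
      · intro x hx
        have hy : |x - x₀| ≤ R := abs_le.2 ⟨by linarith [hx.1], by linarith [hx.2]⟩
        have hy2 : ((x - x₀) / R) ^ 2 ≤ 1 := by
          rw [div_pow, div_le_one (by positivity), sq_le_sq, abs_of_pos hR0]
          exact hy
        have := flux_absorbed (k := P.k (F.th x t)) (p := F.p x t) (q := F.q x t) (u := F.u x t)
          (g := P.g (F.th x t)) (v := F.v x t) (h := P.h (F.th x t)) (ψ := ψ x) (η := dψ x)
          (ε := 1 / R) (D := F.diss x t) (e := F.e x t)
          hb.lam_pos hb.one_le (P.k_pos _).le ((le_abs_self _).trans (hb.abs_k _))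
          (hb.abs_g _) (hb.abs_h _) (by simp only [hψ]; linarith)
          (by simp only [hψ]; linarith [sq_nonneg ((x - x₀) / R)])
          (by
            simp only [hdψ]
            rw [abs_neg, abs_div, abs_mul, abs_two, abs_of_pos (by positivity : 0 < R ^ 2),
              div_le_iff₀ (by positivity)]
            have : 2 * (1 / R) * R ^ 2 = 2 * R := by field_simp
            rw [this]; linarith)
          (by positivity) (by rw [div_le_one hR0]; exact hR)
          (coercive_of_le P.γ₁_pos (hb.coercive _)) rfl
        refine this.trans_eq ?_
        ring
    · apply Continuous.intervalIntegrable; fun_prop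
    · apply Continuous.intervalIntegrable; fun_prop
  have h5 : ∫ t in (0)..t₁, ∫ x in (x₀ - R)..(x₀ + R), ψ x ^ 2 * (F.dflux x t - F.diss x t) ≤
      (8 * B + 8 * B ^ 2 / lam) / R * (∫ t in (0)..t₁, ∫ x in (x₀ - R)..(x₀ + R), F.e x t)
        - lam / 2 * ∫ t in (0)..t₁, ∫ x in (x₀ - R)..(x₀ + R), ψ x ^ 2 * F.v x t ^ 2 := by
    have c1 := continuous_integral_slice (f := fun x t => ψ x ^ 2 * (F.dflux x t - F.diss x t))
      (by fun_prop) (x₀ - R) (x₀ + R)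
    have c2 := continuous_integral_slice ce (x₀ - R) (x₀ + R)
    have c3 := continuous_integral_slice (f := fun x t => ψ x ^ 2 * F.v x t ^ 2)
      (by fun_prop) (x₀ - R) (x₀ + R)
    rw [← intervalIntegral.integral_const_mul, ← intervalIntegral.integral_const_mul,
      ← intervalIntegral.integral_sub]
    · apply intervalIntegral.integral_mono_on ht₁.1
      · exact c1.intervalIntegrable _ _
      · exact ((c2.const_mul _).sub (c3.const_mul _)).intervalIntegrable _ _
      · exact fun t _ => h4 t
    · exact (c2.const_mul _).intervalIntegrable _ _
    · exact (c3.const_mul _).intervalIntegrable _ _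
  rw [intervalIntegral.integral_div, intervalIntegral.integral_div] at h1
  linarith

/-- On a bounded window the energy at time `t₁` and the dissipated energy are at most the initial
energy; only a bound on the energy, uniform in time, is needed to exclude influx from infinity. -/
theorem local_energy_le {lam B : ℝ} (hb : P.Bounds lam B) {E₀ M : ℝ}
    (h0 : ∀ a b, a ≤ b → ∫ x in a..b, F.e x 0 ≤ 2 * E₀)
    (hM : ∀ t ∈ Icc 0 T, ∀ a b, a ≤ b → ∫ x in a..b, F.e x t ≤ M)
    (x₀ : ℝ) {t₁ : ℝ} (ht₁ : t₁ ∈ Icc 0 T) :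
    (∫ x in (x₀ - 1)..(x₀ + 1), F.e x t₁) / 2
      + lam / 2 * ∫ t in (0)..t₁, ∫ x in (x₀ - 1)..(x₀ + 1), F.v x t ^ 2 ≤ E₀ := by
  set X := (∫ x in (x₀ - 1)..(x₀ + 1), F.e x t₁) / 2
      + lam / 2 * ∫ t in (0)..t₁, ∫ x in (x₀ - 1)..(x₀ + 1), F.v x t ^ 2 with hX
  have hlam := hb.lam_pos
  have hB : 0 < B := by linarith [hb.one_le]
  have ce := F.cont_e
  have cv := F.cont_v
  -- comparison with the weight of width `R` on the window
  have key : ∀ R : ℝ, 1 ≤ R → (1 - (1 / R) ^ 2) ^ 2 * X ≤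
      E₀ + (8 * B + 8 * B ^ 2 / lam) / R * (t₁ * M) := fun R hR => by
    have hR0 : 0 < R := by linarith
    have hab : x₀ - R ≤ x₀ + R := by linarith
    have hR1 : (1 / R) ^ 2 ≤ 1 := by
      rw [div_pow, one_pow, div_le_one (by positivity)]; nlinarith
    have main := F.weighted_energy_le hb x₀ hR ht₁
    have hw : ∀ f : ℝ → ℝ, Continuous f → (∀ x, 0 ≤ f x) →
        (1 - (1 / R) ^ 2) ^ 2 * (∫ x in (x₀ - 1)..(x₀ + 1), f x) ≤
          ∫ x in (x₀ - R)..(x₀ + R), (1 - ((x - x₀) / R) ^ 2) ^ 2 * f x := fun f cf hf => by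
      rw [← intervalIntegral.integral_const_mul]
      calc ∫ x in (x₀ - 1)..(x₀ + 1), (1 - (1 / R) ^ 2) ^ 2 * f x
          ≤ ∫ x in (x₀ - 1)..(x₀ + 1), (1 - ((x - x₀) / R) ^ 2) ^ 2 * f x := by
            apply intervalIntegral.integral_mono_on (by linarith)
            · apply Continuous.intervalIntegrable; fun_prop
            · apply Continuous.intervalIntegrable; fun_prop
            · intro x hx
              have hy : |x - x₀| ≤ 1 := abs_le.2 ⟨by linarith [hx.1], by linarith [hx.2]⟩
              have : ((x - x₀) / R) ^ 2 ≤ (1 / R) ^ 2 := by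
                rw [div_pow, div_pow, ← sq_abs (x - x₀)]
                gcongr
              exact mul_le_mul_of_nonneg_right
                (pow_le_pow_left₀ (by linarith) (by linarith) 2) (hf x)
        _ ≤ _ := by
            apply intervalIntegral.integral_mono_interval (by linarith) (by linarith)
              (by linarith)
            · exact Eventually.of_forall fun x => mul_nonneg (sq_nonneg _) (hf x)
            · apply Continuous.intervalIntegrable; fun_prop
    have k1 := hw (fun x => F.e x t₁) (continuous_slice_left ce t₁) fun x => F.e_nonneg x t₁
    have k2 : (1 - (1 / R) ^ 2) ^ 2 *
        (∫ t in (0)..t₁, ∫ x in (x₀ - 1)..(x₀ + 1), F.v x t ^ 2) ≤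
        ∫ t in (0)..t₁, ∫ x in (x₀ - R)..(x₀ + R),
          (1 - ((x - x₀) / R) ^ 2) ^ 2 * F.v x t ^ 2 := by
      rw [← intervalIntegral.integral_const_mul]
      apply intervalIntegral.integral_mono_on ht₁.1
      · exact ((continuous_integral_slice (f := fun x t => F.v x t ^ 2) (by fun_prop) _ _).const_mul
          _).intervalIntegrable _ _
      · exact (continuous_integral_slice
          (f := fun x t => (1 - ((x - x₀) / R) ^ 2) ^ 2 * F.v x t ^ 2)
          (by fun_prop) _ _).intervalIntegrable _ _
      · exact fun t _ => hw (fun x => F.v x t ^ 2) ((continuous_slice_left cv t).pow 2)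
          fun x => sq_nonneg _
    have k3 : ∫ x in (x₀ - R)..(x₀ + R), (1 - ((x - x₀) / R) ^ 2) ^ 2 * F.e x 0 ≤ 2 * E₀ := by
      refine le_trans ?_ (h0 (x₀ - R) (x₀ + R) hab)
      have s1 := continuous_slice_left ce 0
      apply intervalIntegral.integral_mono_on hab
      · apply Continuous.intervalIntegrable; fun_prop
      · apply Continuous.intervalIntegrable; fun_prop
      · intro x hx
        have hy : |x - x₀| ≤ R := abs_le.2 ⟨by linarith [hx.1], by linarith [hx.2]⟩
        have hy2 : ((x - x₀) / R) ^ 2 ≤ 1 := by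
          rw [div_pow, div_le_one (by positivity), sq_le_sq, abs_of_pos hR0]
          exact hy
        have : (1 - ((x - x₀) / R) ^ 2) ^ 2 ≤ 1 :=
          pow_le_one₀ (by linarith) (by linarith [sq_nonneg ((x - x₀) / R)])
        exact mul_le_of_le_one_left (F.e_nonneg x 0) this
    have k4 : ∫ t in (0)..t₁, ∫ x in (x₀ - R)..(x₀ + R), F.e x t ≤ t₁ * M := by
      have : ∫ t in (0)..t₁, M = t₁ * M := by simp
      rw [← this]
      apply intervalIntegral.integral_mono_on ht₁.1
      · exact (continuous_integral_slice ce _ _).intervalIntegrable _ _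
      · simp
      · exact fun t ht => hM t ⟨ht.1, ht.2.trans ht₁.2⟩ _ _ hab
    have k5 : (8 * B + 8 * B ^ 2 / lam) / R *
        (∫ t in (0)..t₁, ∫ x in (x₀ - R)..(x₀ + R), F.e x t) ≤
        (8 * B + 8 * B ^ 2 / lam) / R * (t₁ * M) :=
      mul_le_mul_of_nonneg_left k4 (by positivity)
    have k6 := mul_le_mul_of_nonneg_left k2 (by positivity : 0 ≤ lam / 2)
    rw [hX]
    linarith
  have hinv : Tendsto (fun R : ℝ => 1 / R) atTop (𝓝 0) := by
    simpa using tendsto_inv_atTop_zero (𝕜 := ℝ)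
  have l1 : Tendsto (fun R : ℝ => (1 - (1 / R) ^ 2) ^ 2 * X) atTop (𝓝 X) := by
    have := (((hinv.pow 2).const_sub 1).pow 2).mul_const X
    simpa using this
  have l2 : Tendsto (fun R : ℝ => E₀ + (8 * B + 8 * B ^ 2 / lam) / R * (t₁ * M)) atTop
      (𝓝 E₀) := by
    have := (((hinv.const_mul (8 * B + 8 * B ^ 2 / lam)).mul_const (t₁ * M)).const_add E₀)
    simpa [div_eq_mul_inv] using this
  exact le_of_tendsto_of_tendsto l1 l2 ((eventually_ge_atTop 1).mono key)

end Flow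

/-! ### The equation for `J` -/

namespace Flow

variable {P : Coeffs} {T : ℝ} (F : Flow P T)

/-- The quantity `J = u_x + (h / g) θ_t`. -/
def J (x t : ℝ) : ℝ := F.v x t + P.m (F.th x t) * F.q x t

/-- The part of the source of the equation for `J` that is kept in divergence form. -/
def G (x t : ℝ) : ℝ :=
  P.m (F.th x t) * P.k (F.th x t) * F.p x t - P.m (F.th x t) * P.h (F.th x t) * F.u x t

/-- The part of the source of the equation for `J` that is controlled by the energy density. -/
def Q (x t : ℝ) : ℝ :=
  P.dm (F.th x t) * F.q x t ^ 2
    + (P.m (F.th x t) * (P.dk (F.th x t) / 2)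
      - (P.dm (F.th x t) * P.k (F.th x t) + P.m (F.th x t) * P.dk (F.th x t))) * F.p x t ^ 2
    - P.γ₁ * P.m (F.th x t) * F.q x t
    + (P.dm (F.th x t) * P.h (F.th x t) + P.m (F.th x t) * P.dh (F.th x t)) * F.p x t * F.u x t

theorem cont_J : Continuous fun y : ℝ × ℝ => F.J y.1 y.2 :=
  F.cont_v.add (F.cont_m.mul F.cont_q)

theorem cont_G : Continuous fun y : ℝ × ℝ => F.G y.1 y.2 :=
  ((F.cont_m.mul F.cont_k).mul F.cont_p).sub ((F.cont_m.mul F.cont_h).mul F.cont_u)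

theorem cont_Q : Continuous fun y : ℝ × ℝ => F.Q y.1 y.2 := by
  have := F.cont_m
  have := F.cont_dm
  have := F.cont_k
  have := F.cont_dk
  have := F.cont_h
  have := F.cont_dh
  have := F.cont_p
  have := F.cont_q
  have := F.cont_u
  unfold Q
  fun_prop

theorem S_eq (x t : ℝ) : F.S x t = P.g (F.th x t) * F.J x t := by
  unfold S J
  rw [mul_add, ← mul_assoc, P.g_mul_m]

/-- The space derivative of `G`. -/
def dG (x t : ℝ) : ℝ :=
  (P.dm (F.th x t) * P.k (F.th x t) + P.m (F.th x t) * P.dk (F.th x t)) * F.p x t ^ 2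
    + P.m (F.th x t) * P.k (F.th x t) * F.a x t
    - (P.dm (F.th x t) * P.h (F.th x t) + P.m (F.th x t) * P.dh (F.th x t)) * F.p x t * F.u x t
    - P.m (F.th x t) * P.h (F.th x t) * F.v x t

theorem cont_dG : Continuous fun y : ℝ × ℝ => F.dG y.1 y.2 := by
  have := F.cont_m
  have := F.cont_dm
  have := F.cont_k
  have := F.cont_dk
  have := F.cont_h
  have := F.cont_dh
  have := F.cont_p
  have := F.cont_a
  have := F.cont_u
  have := F.cont_v
  unfold dG
  fun_prop

theorem hasDerivAt_G (x t : ℝ) : HasDerivAt (fun y => F.G y t) (F.dG x t) x := by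
  have hm := (P.hasDerivAt_m _).comp x (F.th_x x t)
  have hk := (P.hasDerivAt_k _).comp x (F.th_x x t)
  have hh := (P.hasDerivAt_h _).comp x (F.th_x x t)
  refine (((hm.mul hk).mul (F.p_x x t)).sub ((hm.mul hh).mul (F.u_x x t))).congr_deriv ?_
  simp only [Function.comp, Pi.mul_apply, dG]
  ring

/-- The equation `J_t = (g J)_xx + G_x + Q`, in which `z = u_xt = (g J)_xx`. The term `-h u_x` of the
wave equation is split between `G` and `Q`, so that no term of order zero in `J` remains. -/
theorem hasDerivAt_J (x : ℝ) {t : ℝ} (ht : t ∈ Ioo 0 T) :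
    HasDerivAt (fun s => F.J x s) (F.z x t + F.dG x t + F.Q x t) t := by
  have hm := (P.hasDerivAt_m _).comp t (F.th_t x t ht)
  refine ((F.v_t x t ht).add (hm.mul (F.q_t x t ht))).congr_deriv ?_
  simp only [Function.comp, dG, Q]
  rw [F.wave]
  ring

/-- The equation for `J` tested with a function `φ` that vanishes to first order at the ends of
`[a, b]`. -/
theorem weak_form {a b t₁ : ℝ} (hab : a ≤ b) (ht₁ : t₁ ∈ Icc 0 T) {φ φx φxx φt : ℝ → ℝ → ℝ}
    (cφ : Continuous fun y : ℝ × ℝ => φ y.1 y.2) (cφx : Continuous fun y : ℝ × ℝ => φx y.1 y.2)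
    (cφxx : Continuous fun y : ℝ × ℝ => φxx y.1 y.2)
    (cφt : Continuous fun y : ℝ × ℝ => φt y.1 y.2)
    (hφ : ∀ x t, HasDerivAt (fun y => φ y t) (φx x t) x)
    (hφx : ∀ x t, HasDerivAt (fun y => φx y t) (φxx x t) x)
    (hφt : ∀ x, ∀ t ∈ Ioo 0 t₁, HasDerivAt (fun s => φ x s) (φt x t) t)
    (ha : ∀ t, φ a t = 0) (hb : ∀ t, φ b t = 0) (ha' : ∀ t, φx a t = 0) (hb' : ∀ t, φx b t = 0) :
    (∫ x in a..b, φ x t₁ * F.J x t₁) - (∫ x in a..b, φ x 0 * F.J x 0) =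
      ∫ t in (0)..t₁, ∫ x in a..b, ((φt x t + P.g (F.th x t) * φxx x t) * F.J x t
        - φx x t * F.G x t + φ x t * F.Q x t) := by
  have cJ := F.cont_J
  have cG := F.cont_G
  have cQ := F.cont_Q
  have cdG := F.cont_dG
  have cz := F.cont_z
  have cw := F.cont_w
  have cS := F.cont_S
  have cg := F.cont_g
  rw [integral_sub_eq_integral_time_deriv (f := fun x t => φ x t * F.J x t)
    (f' := fun x t => φt x t * F.J x t + φ x t * (F.z x t + F.dG x t + F.Q x t)) (by fun_prop)
    (by fun_prop) hab ht₁.1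
    fun x t ht => (hφt x t ht).mul (F.hasDerivAt_J x ⟨ht.1, ht.2.trans_le ht₁.2⟩)]
  congr 1
  funext t
  have s1 := continuous_slice_left cφ t
  have s2 := continuous_slice_left cφx t
  have s3 := continuous_slice_left cφxx t
  have s4 := continuous_slice_left cφt t
  have s5 := continuous_slice_left cJ t
  have s6 := continuous_slice_left cG t
  have s7 := continuous_slice_left cQ t
  have s8 := continuous_slice_left cdG t
  have s9 := continuous_slice_left cz t
  have s10 := continuous_slice_left cw t
  have s11 := continuous_slice_left cS t
  have s12 := continuous_slice_left (f := fun x t => P.g (F.th x t)) cg t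
  have key : ∫ x in a..b, (φx x t * F.w x t + φ x t * F.z x t
      - (φxx x t * F.S x t + φx x t * F.w x t) + (φx x t * F.G x t + φ x t * F.dG x t)) = 0 := by
    rw [intervalIntegral.integral_eq_sub_of_hasDerivAt
      (f := fun x => φ x t * F.w x t - φx x t * F.S x t + φ x t * F.G x t)]
    · rw [ha, hb, ha', hb']; ring
    · exact fun x _ => (((hφ x t).mul (F.w_x x t)).sub ((hφx x t).mul (F.heat x t))).add
        ((hφ x t).mul (F.hasDerivAt_G x t))
    · apply Continuous.intervalIntegrable; fun_prop
  rw [← sub_eq_zero, ← intervalIntegral.integral_sub, ← key]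
  · congr 1
    funext x
    rw [S_eq]
    ring
  · apply Continuous.intervalIntegrable; fun_prop
  · apply Continuous.intervalIntegrable; fun_prop

end Flow

/-! ### The heat kernel -/

/-- The heat kernel without its normalising constant; its integral is `2 √π`. -/
def heatKernel (σ y : ℝ) : ℝ := Real.exp (-(y ^ 2 / (4 * σ))) / √σ

/-- The first space derivative of the heat kernel. -/
def heatKernel₁ (σ y : ℝ) : ℝ := -(y / (2 * σ)) * heatKernel σ y

/-- The second space derivative of the heat kernel. -/
def heatKernel₂ (σ y : ℝ) : ℝ := (y ^ 2 / (4 * σ ^ 2) - 1 / (2 * σ)) * heatKernel σ y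

theorem hasDerivAt_heatKernel (σ y : ℝ) : HasDerivAt (heatKernel σ) (heatKernel₁ σ y) y := by
  have h := (((((hasDerivAt_id y).pow 2).div_const (4 * σ)).neg).exp).div_const (√σ)
  refine h.congr_deriv ?_
  simp only [id, heatKernel₁, heatKernel, Pi.pow_apply, Pi.neg_apply]
  rcases eq_or_ne σ 0 with rfl | hσ
  · simp
  push_cast
  field_simp
  ring

theorem hasDerivAt_heatKernel₁ {σ : ℝ} (hσ : σ ≠ 0) (y : ℝ) :
    HasDerivAt (heatKernel₁ σ) (heatKernel₂ σ y) y := by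
  have h := (((hasDerivAt_id y).div_const (2 * σ)).neg).mul (hasDerivAt_heatKernel σ y)
  refine h.congr_deriv ?_
  simp only [id, heatKernel₁, heatKernel₂, Pi.neg_apply]
  field_simp
  ring

/-- The heat equation. -/
theorem hasDerivAt_heatKernel_time {σ : ℝ} (hσ : 0 < σ) (y : ℝ) :
    HasDerivAt (fun s => heatKernel s y) (heatKernel₂ σ y) σ := by
  have h1 : HasDerivAt (fun s : ℝ => -(y ^ 2 / (4 * s))) (y ^ 2 / (4 * σ ^ 2)) σ := by
    have := ((((hasDerivAt_id σ).const_mul 4).inv (by simpa using hσ.ne')).const_mul (y ^ 2)).neg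
    refine (this.congr_deriv ?_).congr_of_eventuallyEq (Eventually.of_forall fun s => ?_)
    · simp only [id]; field_simp
    · simp [div_eq_mul_inv]
  have h2 := h1.exp.div ((hasDerivAt_id σ).sqrt hσ.ne') (Real.sqrt_ne_zero'.2 hσ)
  refine h2.congr_deriv ?_
  have hs : √σ ≠ 0 := Real.sqrt_ne_zero'.2 hσ
  have hs2 : √σ ^ 2 = σ := Real.sq_sqrt hσ.le
  simp only [id, heatKernel₂, heatKernel]
  rw [hs2]
  generalize √σ = s at hs hs2
  subst hs2
  field_simp

theorem heatKernel_nonneg (σ y : ℝ) : 0 ≤ heatKernel σ y := by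
  unfold heatKernel; positivity

theorem integral_exp_neg_sq_div {c : ℝ} (hc : 0 < c) :
    ∫ y : ℝ, Real.exp (-(y ^ 2 / c)) = √(Real.pi * c) := by
  have := integral_gaussian c⁻¹
  rw [div_inv_eq_mul] at this
  rw [← this]
  congr 1
  funext y
  congr 1
  field_simp

theorem integrable_exp_neg_sq_div {c : ℝ} (hc : 0 < c) :
    Integrable fun y : ℝ => Real.exp (-(y ^ 2 / c)) := by
  have := integrable_exp_neg_mul_sq (inv_pos.2 hc)
  refine this.congr (Eventually.of_forall fun y => ?_)
  simp only
  congr 1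
  field_simp

theorem intervalIntegral_exp_neg_sq_div_le {c : ℝ} (hc : 0 < c) (x₀ : ℝ) {a b : ℝ} (hab : a ≤ b) :
    ∫ x in a..b, Real.exp (-((x - x₀) ^ 2 / c)) ≤ √(Real.pi * c) := by
  rw [← integral_exp_neg_sq_div hc, intervalIntegral.integral_of_le hab,
    ← integral_sub_right_eq_self (fun y => Real.exp (-(y ^ 2 / c))) x₀]
  exact setIntegral_le_integral ((integrable_exp_neg_sq_div hc).comp_sub_right x₀)
    (Eventually.of_forall fun x => (Real.exp_pos _).le)

theorem integral_heatKernel_le {σ : ℝ} (hσ : 0 < σ) (x₀ : ℝ) {a b : ℝ} (hab : a ≤ b) :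
    ∫ x in a..b, heatKernel σ (x - x₀) ≤ √(Real.pi * 4) := by
  unfold heatKernel
  rw [intervalIntegral.integral_div, div_le_iff₀ (Real.sqrt_pos.2 hσ),
    ← Real.sqrt_mul (by positivity), mul_assoc]
  exact intervalIntegral_exp_neg_sq_div_le (by positivity) x₀ hab

/-- As `σ → 0` the heat kernel concentrates at the origin. -/
theorem tendsto_integral_heatKernel {f : ℝ → ℝ} (hf : Continuous f) (x₀ : ℝ) {ρ : ℝ}
    (hρ : 0 < ρ) :
    Tendsto (fun σ => ∫ x in (x₀ - ρ)..(x₀ + ρ), heatKernel σ (x - x₀) * f x) (𝓝[>] 0)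
      (𝓝 (√(Real.pi * 4) * f x₀)) := by
  have hπ : 0 < √(Real.pi * 4) := Real.sqrt_pos.2 (by positivity)
  set g : ℝ → ℝ := (Ioc (x₀ - ρ) (x₀ + ρ)).indicator f with hg
  have gi : Integrable g :=
    (hf.integrableOn_Ioc).integrable_indicator measurableSet_Ioc
  have gc : ContinuousAt g x₀ := by
    refine hf.continuousAt.congr ?_
    filter_upwards [Ioo_mem_nhds (a := x₀ - ρ) (b := x₀ + ρ) (by linarith) (by linarith)] with x hx
    rw [hg, indicator_of_mem (Ioo_subset_Ioc_self hx)]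
  have gx : g x₀ = f x₀ := by
    rw [hg, indicator_of_mem]; exact ⟨by linarith, by linarith⟩
  have main := tendsto_integral_comp_smul_smul_of_integrable' (μ := (volume : Measure ℝ))
    (φ := fun y : ℝ => Real.exp (-(y ^ 2 / 4)) / √(Real.pi * 4)) (fun y => by positivity)
    (by rw [integral_div, integral_exp_neg_sq_div (by norm_num), div_self hπ.ne'])
    (by
      have h1 := (tendsto_rpow_abs_mul_exp_neg_mul_sq_cocompact (a := 1 / 4) (by norm_num)
        1).div_const √(Real.pi * 4)
      rw [zero_div] at h1
      rw [Metric.cobounded_eq_cocompact]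
      refine h1.congr fun y => ?_
      simp only [Module.finrank_self, pow_one, Real.rpow_one, Real.norm_eq_abs]
      rw [mul_div_assoc]
      congr 4
      ring) gi gc
  have hc : Tendsto (fun σ : ℝ => (√σ)⁻¹) (𝓝[>] 0) atTop := by
    refine tendsto_inv_nhdsGT_zero.comp (tendsto_nhdsWithin_iff.2 ⟨?_, ?_⟩)
    · have := Real.continuous_sqrt.tendsto 0
      rw [Real.sqrt_zero] at this
      exact this.mono_left nhdsWithin_le_nhds
    · filter_upwards [self_mem_nhdsWithin] with σ hσ using Real.sqrt_pos.2 hσ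
  have h2 := (main.comp hc).const_mul √(Real.pi * 4)
  rw [gx] at h2
  refine h2.congr' ?_
  filter_upwards [self_mem_nhdsWithin] with σ hσ
  have hσ' : 0 < σ := hσ
  simp only [Function.comp, Module.finrank_self, pow_one, smul_eq_mul]
  rw [intervalIntegral.integral_of_le (by linarith), ← integral_const_mul,
    ← integral_indicator measurableSet_Ioc]
  congr 1
  funext x
  by_cases hx : x ∈ Ioc (x₀ - ρ) (x₀ + ρ)
  · rw [indicator_of_mem hx, hg, indicator_of_mem hx, heatKernel]
    have : -((x - x₀) ^ 2 / (4 * σ)) = -(((√σ)⁻¹ * (x₀ - x)) ^ 2 / 4) := by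
      rw [mul_pow, inv_pow, Real.sq_sqrt hσ'.le]
      field_simp
      ring
    rw [this]
    field_simp
  · rw [indicator_of_notMem hx, hg, indicator_of_notMem hx]
    ring

/-! ### Gaussian bounds, cutoffs and bounds for the coefficients -/

section KernelBounds

variable {s : ℝ}

theorem sqrt_pow_four (s : ℝ) : √(s ^ 4) = s ^ 2 := by
  rw [show s ^ 4 = (s ^ 2) ^ 2 by ring, Real.sqrt_sq (sq_nonneg s)]

/-- The Gaussian of twice the variance of the heat kernel at time `s⁴`. -/
def gauss (s y : ℝ) : ℝ := Real.exp (-(y ^ 2 / (8 * s ^ 4)))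

theorem gauss_pos (s y : ℝ) : 0 < gauss s y := Real.exp_pos _

theorem gauss_le_one (s y : ℝ) : gauss s y ≤ 1 :=
  Real.exp_le_one_iff.2 (neg_nonpos.2 (by positivity))

theorem continuous_gauss (s : ℝ) : Continuous (gauss s) := by unfold gauss; fun_prop

theorem heatKernel_eq_gauss (hs : 0 < s) (y : ℝ) :
    heatKernel (s ^ 4) y = gauss s y * gauss s y / s ^ 2 := by
  rw [heatKernel, gauss, ← Real.exp_add, sqrt_pow_four]
  congr 2
  field_simp
  ring

theorem poly_mul_gauss_le (hs : 0 < s) (y : ℝ) :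
    (1 + (|y| / s ^ 2) ^ 2 / 8 + (|y| / s ^ 2) ^ 4 / 128) * gauss s y ≤ 1 := by
  have h0 : 0 ≤ y ^ 2 / (8 * s ^ 4) := by positivity
  have h1 := Real.quadratic_le_exp_of_nonneg h0
  have h2 : 1 + (|y| / s ^ 2) ^ 2 / 8 + (|y| / s ^ 2) ^ 4 / 128 =
      1 + y ^ 2 / (8 * s ^ 4) + (y ^ 2 / (8 * s ^ 4)) ^ 2 / 2 := by
    rw [← sq_abs y]
    field_simp
    ring
  rw [h2, gauss, Real.exp_neg, ← div_eq_mul_inv, div_le_one (Real.exp_pos _)]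
  exact h1

theorem heatKernel_le (hs : 0 < s) (y : ℝ) : heatKernel (s ^ 4) y ≤ gauss s y / s ^ 2 := by
  rw [heatKernel_eq_gauss hs]
  exact div_le_div_of_nonneg_right
    (mul_le_of_le_one_left (gauss_pos s y).le (gauss_le_one s y)) (by positivity)

theorem abs_heatKernel₁_le (hs : 0 < s) (y : ℝ) :
    |heatKernel₁ (s ^ 4) y| ≤ gauss s y / s ^ 4 := by
  have hη := gauss_pos s y
  have h1 := poly_mul_gauss_le hs y
  have e : |heatKernel₁ (s ^ 4) y| = (|y| / s ^ 2 / 2 * gauss s y) * (gauss s y / s ^ 4) := by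
    rw [heatKernel₁, heatKernel_eq_gauss hs, abs_mul, abs_neg, abs_div,
      abs_of_pos (by positivity : 0 < 2 * s ^ 4),
      abs_of_pos (by positivity : 0 < gauss s y * gauss s y / s ^ 2)]
    field_simp
  rw [e]
  refine mul_le_of_le_one_left (by positivity) (le_trans ?_ h1)
  refine mul_le_mul_of_nonneg_right ?_ hη.le
  generalize |y| / s ^ 2 = z
  nlinarith [sq_nonneg (z - 2), sq_nonneg (z ^ 2)]

theorem abs_mul_heatKernel₁_le (hs : 0 < s) (y : ℝ) :
    |y| * |heatKernel₁ (s ^ 4) y| ≤ 4 * (gauss s y / s ^ 2) := by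
  have hη := gauss_pos s y
  have h1 := poly_mul_gauss_le hs y
  have e : |y| * |heatKernel₁ (s ^ 4) y| =
      4 * (((|y| / s ^ 2) ^ 2 / 8 * gauss s y) * (gauss s y / s ^ 2)) := by
    rw [heatKernel₁, heatKernel_eq_gauss hs, abs_mul, abs_neg, abs_div,
      abs_of_pos (by positivity : 0 < 2 * s ^ 4),
      abs_of_pos (by positivity : 0 < gauss s y * gauss s y / s ^ 2)]
    field_simp
    ring
  rw [e]
  refine mul_le_mul_of_nonneg_left ?_ (by norm_num)
  refine mul_le_of_le_one_left (by positivity) (le_trans ?_ h1)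
  refine mul_le_mul_of_nonneg_right ?_ hη.le
  generalize |y| / s ^ 2 = z
  nlinarith [sq_nonneg (z ^ 2)]

theorem sqrt_abs_mul_heatKernel₂_le (hs : 0 < s) (y : ℝ) :
    √|y| * |heatKernel₂ (s ^ 4) y| ≤ 100 * (gauss s y / s ^ 5) := by
  have hη := gauss_pos s y
  have h1 := poly_mul_gauss_le hs y
  set z := |y| / s ^ 2 with hz
  have hz0 : 0 ≤ z := by positivity
  have hyz : |y| = s ^ 2 * z := by rw [hz]; field_simp
  have e1 : √|y| ≤ s * (1 + z) := by
    rw [hyz, Real.sqrt_mul (sq_nonneg s), Real.sqrt_sq hs.le]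
    refine mul_le_mul_of_nonneg_left ?_ hs.le
    exact Real.sqrt_le_iff.2 ⟨by linarith, by nlinarith⟩
  have e2 : |heatKernel₂ (s ^ 4) y| ≤
      (z ^ 2 / 4 + 1 / 2) * (gauss s y * gauss s y / s ^ 6) := by
    have : heatKernel₂ (s ^ 4) y =
        (z ^ 2 / 4 - 1 / 2) * (gauss s y * gauss s y / s ^ 6) := by
      rw [heatKernel₂, heatKernel_eq_gauss hs, ← sq_abs y, hyz]
      field_simp
    rw [this, abs_mul, abs_of_pos (by positivity : 0 < gauss s y * gauss s y / s ^ 6)]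
    refine mul_le_mul_of_nonneg_right (abs_le.2 ⟨?_, ?_⟩) (by positivity) <;>
      nlinarith [sq_nonneg z]
  calc √|y| * |heatKernel₂ (s ^ 4) y|
      ≤ (s * (1 + z)) * ((z ^ 2 / 4 + 1 / 2) * (gauss s y * gauss s y / s ^ 6)) :=
        mul_le_mul e1 e2 (abs_nonneg _) (by positivity)
    _ = ((1 + z) * (z ^ 2 / 4 + 1 / 2) * gauss s y) * (gauss s y / s ^ 5) := by
        field_simp
    _ ≤ 100 * (gauss s y / s ^ 5) := by
        refine mul_le_mul_of_nonneg_right ?_ (by positivity)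
        have : (1 + z) * (z ^ 2 / 4 + 1 / 2) ≤ 100 * (1 + z ^ 2 / 8 + z ^ 4 / 128) := by
          nlinarith [sq_nonneg (z - 1), sq_nonneg (z ^ 2 - z)]
        nlinarith [mul_le_mul_of_nonneg_right this hη.le]

theorem integral_gauss_le (hs : 0 < s) (x₀ : ℝ) {a b : ℝ} (hab : a ≤ b) :
    ∫ x in a..b, gauss s (x - x₀) ≤ 6 * s ^ 2 := by
  refine (intervalIntegral_exp_neg_sq_div_le (by positivity) x₀ hab).trans ?_
  refine Real.sqrt_le_iff.2 ⟨by positivity, ?_⟩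
  have := Real.pi_le_four
  nlinarith [mul_le_mul_of_nonneg_right this (by positivity : 0 ≤ 8 * s ^ 4)]

theorem integral_gauss_mul_le (hs : 0 < s) (x₀ : ℝ) {a b : ℝ} (hab : a ≤ b) {f : ℝ → ℝ}
    (hf : Continuous f) :
    ∫ x in a..b, gauss s (x - x₀) * |f x| ≤ 2 * s * √(∫ x in a..b, f x ^ 2) := by
  have cg : Continuous fun x => gauss s (x - x₀) := (continuous_gauss s).comp (by fun_prop)
  have h1 := abs_integral_mul_le cg hf hab
  simp only [abs_of_pos (gauss_pos s _)] at h1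
  refine h1.trans (mul_le_mul_of_nonneg_right ?_ (Real.sqrt_nonneg _))
  refine Real.sqrt_le_iff.2 ⟨by positivity, ?_⟩
  have h2 : ∀ x, gauss s (x - x₀) ^ 2 = Real.exp (-((x - x₀) ^ 2 / (4 * s ^ 4))) := fun x => by
    rw [gauss, ← Real.exp_nat_mul]
    congr 1
    push_cast
    field_simp
    ring
  simp only [h2]
  refine (intervalIntegral_exp_neg_sq_div_le (by positivity) x₀ hab).trans ?_
  refine Real.sqrt_le_iff.2 ⟨by positivity, ?_⟩
  have := Real.pi_le_four
  nlinarith [mul_le_mul_of_nonneg_right this (by positivity : 0 ≤ 4 * s ^ 4)]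

end KernelBounds

section Cutoff

/-- The cutoff `(1 - (y / ρ)²)²`, which vanishes to first order at `y = ± ρ`. -/
def cutoff (ρ y : ℝ) : ℝ := (1 - (y / ρ) ^ 2) ^ 2

/-- The first derivative of the cutoff. -/
def cutoff₁ (ρ y : ℝ) : ℝ := -(4 * y / ρ ^ 2) * (1 - (y / ρ) ^ 2)

/-- The second derivative of the cutoff. -/
def cutoff₂ (ρ y : ℝ) : ℝ := -(4 / ρ ^ 2) * (1 - (y / ρ) ^ 2) + 8 * (y / ρ) ^ 2 / ρ ^ 2

variable {ρ : ℝ}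

theorem hasDerivAt_cutoff (hρ : 0 < ρ) (y : ℝ) : HasDerivAt (cutoff ρ) (cutoff₁ ρ y) y := by
  have := ((((hasDerivAt_id y).div_const ρ).pow 2).const_sub 1).pow 2
  refine this.congr_deriv ?_
  simp only [id, cutoff₁, Pi.pow_apply]
  push_cast
  field_simp
  ring

theorem hasDerivAt_cutoff₁ (hρ : 0 < ρ) (y : ℝ) : HasDerivAt (cutoff₁ ρ) (cutoff₂ ρ y) y := by
  have := ((((hasDerivAt_id y).const_mul 4).div_const (ρ ^ 2)).neg).mul
    ((((hasDerivAt_id y).div_const ρ).pow 2).const_sub 1)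
  refine this.congr_deriv ?_
  simp only [id, cutoff₂, Pi.pow_apply, Pi.neg_apply]
  push_cast
  field_simp
  ring

theorem continuous_cutoff (ρ : ℝ) : Continuous (cutoff ρ) := by unfold cutoff; fun_prop
theorem continuous_cutoff₁ (ρ : ℝ) : Continuous (cutoff₁ ρ) := by unfold cutoff₁; fun_prop
theorem continuous_cutoff₂ (ρ : ℝ) : Continuous (cutoff₂ ρ) := by unfold cutoff₂; fun_prop

variable {y : ℝ}

theorem div_sq_le_one (hρ : 0 < ρ) (hy : |y| ≤ ρ) : (y / ρ) ^ 2 ≤ 1 := by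
  rw [div_pow, div_le_one (by positivity), sq_le_sq, abs_of_pos hρ]
  exact hy

theorem cutoff_nonneg (ρ y : ℝ) : 0 ≤ cutoff ρ y := sq_nonneg _

theorem cutoff_le_one (hρ : 0 < ρ) (hy : |y| ≤ ρ) : cutoff ρ y ≤ 1 := by
  have := div_sq_le_one hρ hy
  exact pow_le_one₀ (by linarith) (by linarith [sq_nonneg (y / ρ)])

theorem abs_cutoff₁_le (hρ : 0 < ρ) (hy : |y| ≤ ρ) : |cutoff₁ ρ y| ≤ 4 / ρ ^ 2 * |y| := by
  have h := div_sq_le_one hρ hy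
  rw [cutoff₁, abs_mul, abs_neg, abs_div, abs_mul, abs_of_nonneg (sub_nonneg.2 h),
    abs_of_pos (by positivity : 0 < ρ ^ 2), abs_of_pos (by norm_num : (0 : ℝ) < 4)]
  have : 4 / ρ ^ 2 * |y| = 4 * |y| / ρ ^ 2 := by ring
  rw [this]
  exact mul_le_of_le_one_right (by positivity) (by linarith [sq_nonneg (y / ρ)])

theorem abs_cutoff₂_le (hρ : 0 < ρ) (hy : |y| ≤ ρ) : |cutoff₂ ρ y| ≤ 8 / ρ ^ 2 := by
  have h := div_sq_le_one hρ hy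
  have h0 := sq_nonneg (y / ρ)
  have e : cutoff₂ ρ y = (12 * (y / ρ) ^ 2 - 4) / ρ ^ 2 := by
    rw [cutoff₂]; ring
  rw [e, abs_div, abs_of_pos (by positivity : 0 < ρ ^ 2)]
  exact div_le_div_of_nonneg_right (abs_le.2 ⟨by linarith, by linarith⟩) (by positivity)

end Cutoff

theorem abs_sub_le_sqrt_mul {f f' : ℝ → ℝ} (hf : ∀ x, HasDerivAt f (f' x) x)
    (hc : Continuous f') {a b : ℝ} (hab : a ≤ b) :
    |f b - f a| ≤ √(b - a) * √(∫ x in a..b, f' x ^ 2) := by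
  rw [← intervalIntegral.integral_eq_sub_of_hasDerivAt (fun x _ => hf x)
    (hc.intervalIntegrable _ _)]
  refine (intervalIntegral.abs_integral_le_integral_abs hab).trans ?_
  have := abs_integral_mul_le (continuous_const (y := (1 : ℝ))) hc hab
  simpa using this

theorem Coeffs.Bounds.one_le_one_add {P : Coeffs} {lam B : ℝ} (hb : P.Bounds lam B) :
    1 ≤ 1 + 1 / lam := by
  have := one_div_pos.2 hb.lam_pos
  linarith

namespace Flow

variable {P : Coeffs} {T : ℝ} (F : Flow P T) {lam B : ℝ}

theorem abs_g_sub_le (hb : P.Bounds lam B) (s₁ s₂ : ℝ) :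
    |P.g s₁ - P.g s₂| ≤ B * |s₁ - s₂| :=
  Convex.norm_image_sub_le_of_norm_hasDerivWithin_le (s := univ)
    (fun x _ => (P.hasDerivAt_g x).hasDerivWithinAt) (fun x _ => hb.abs_dg x) convex_univ
    (mem_univ _) (mem_univ _)

theorem sqrt_le_of_le {X E D : ℝ} (hD : 1 ≤ D) (hE : 0 ≤ E) (hX : X ≤ 2 * E * D) :
    √X ≤ 2 * D * √E := by
  refine Real.sqrt_le_iff.2 ⟨by positivity, ?_⟩
  rw [mul_pow, Real.sq_sqrt hE]
  nlinarith [mul_nonneg hE (by linarith : 0 ≤ D), mul_nonneg (mul_nonneg hE (by linarith : 0 ≤ D))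
    (by linarith : 0 ≤ D - 1)]

theorem p_sq_le (hb : P.Bounds lam B) (x t : ℝ) :
    F.p x t ^ 2 ≤ (1 + 1 / lam) * F.e x t := by
  have h1 := F.k_mul_sq_le_e x t
  have h2 := mul_le_mul_of_nonneg_right (hb.le_k (F.th x t)) (sq_nonneg (F.p x t))
  have h3 : F.p x t ^ 2 ≤ F.e x t / lam := by
    rw [le_div_iff₀ hb.lam_pos]; linarith
  have := F.e_nonneg x t
  have h4 : (1 + 1 / lam) * F.e x t = F.e x t + F.e x t / lam := by ring
  linarith

theorem integral_sq_le_of_sq_le {f : ℝ → ℝ → ℝ} (hf : Continuous fun y : ℝ × ℝ => f y.1 y.2)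
    {D E t a b : ℝ} (hD : 0 ≤ D) (hab : a ≤ b) (h : ∀ x, f x t ^ 2 ≤ D * F.e x t)
    (hE : ∫ x in a..b, F.e x t ≤ 2 * E) : ∫ x in a..b, f x t ^ 2 ≤ 2 * E * D := by
  have s1 := continuous_slice_left hf t
  have s2 := continuous_slice_left F.cont_e t
  calc ∫ x in a..b, f x t ^ 2 ≤ ∫ x in a..b, D * F.e x t := by
        apply intervalIntegral.integral_mono_on hab
        · apply Continuous.intervalIntegrable; fun_prop
        · apply Continuous.intervalIntegrable; fun_prop
        · exact fun x _ => h x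
    _ = D * ∫ x in a..b, F.e x t := intervalIntegral.integral_const_mul _ _
    _ ≤ D * (2 * E) := mul_le_mul_of_nonneg_left hE hD
    _ = _ := by ring

/-- The coefficient `g(θ)` is Hölder continuous in space with exponent `1 / 2` and a constant that
is small with the energy. -/
theorem abs_g_sub_le_sqrt (hb : P.Bounds lam B) {E x₀ ρ t : ℝ} (hE : 0 ≤ E)
    (he : ∫ x in (x₀ - ρ)..(x₀ + ρ), F.e x t ≤ 2 * E) {x : ℝ} (hx : |x - x₀| ≤ ρ) :
    |P.g (F.th x t) - P.g (F.th x₀ t)| ≤ 2 * B * (1 + 1 / lam) * √E * √|x - x₀| := by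
  have hD := hb.one_le_one_add
  have hB : 0 ≤ B := by linarith [hb.one_le]
  have hρ : 0 ≤ ρ := (abs_nonneg _).trans hx
  have cp := continuous_slice_left F.cont_p t
  have hp := sqrt_le_of_le hD hE (F.integral_sq_le_of_sq_le F.cont_p (by linarith)
    (by linarith : x₀ - ρ ≤ x₀ + ρ) (fun x => F.p_sq_le hb x t) he)
  have hx' := abs_le.1 hx
  have hmono : ∀ a b, x₀ - ρ ≤ a → a ≤ b → b ≤ x₀ + ρ →
      √(∫ x in a..b, F.p x t ^ 2) ≤ 2 * (1 + 1 / lam) * √E := fun a b h1 h2 h3 => by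
    refine (Real.sqrt_le_sqrt ?_).trans hp
    apply intervalIntegral.integral_mono_interval h1 h2 h3
    · exact Eventually.of_forall fun x => sq_nonneg _
    · apply Continuous.intervalIntegrable; fun_prop
  have hθ : |F.th x t - F.th x₀ t| ≤ √|x - x₀| * (2 * (1 + 1 / lam) * √E) := by
    rcases le_total x₀ x with h | h
    · rw [abs_of_nonneg (sub_nonneg.2 h)]
      exact (abs_sub_le_sqrt_mul (fun y => F.th_x y t) cp h).trans
        (mul_le_mul_of_nonneg_left (hmono _ _ (by linarith) h (by linarith)) (Real.sqrt_nonneg _))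
    · rw [abs_sub_comm, abs_sub_comm x, abs_of_nonneg (sub_nonneg.2 h)]
      exact (abs_sub_le_sqrt_mul (fun y => F.th_x y t) cp h).trans
        (mul_le_mul_of_nonneg_left (hmono _ _ (by linarith) h (by linarith)) (Real.sqrt_nonneg _))
  calc _ ≤ B * |F.th x t - F.th x₀ t| := abs_g_sub_le hb _ _
    _ ≤ B * (√|x - x₀| * (2 * (1 + 1 / lam) * √E)) := mul_le_mul_of_nonneg_left hθ hB
    _ = _ := by ring

theorem abs_G_le (hb : P.Bounds lam B) (x t : ℝ) : |F.G x t| ≤ B * |F.p x t| + B * |F.u x t| := by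
  unfold G
  refine (abs_sub _ _).trans (add_le_add ?_ ?_) <;> rw [abs_mul]
  · exact mul_le_mul_of_nonneg_right (hb.abs_mk _) (abs_nonneg _)
  · exact mul_le_mul_of_nonneg_right (hb.abs_mh _) (abs_nonneg _)

theorem abs_Q_le (hb : P.Bounds lam B) (x t : ℝ) :
    |F.Q x t| ≤ 2 * B * (1 + 1 / lam) * F.e x t + B * |F.q x t| := by
  have hlam := hb.lam_pos
  have hB : 0 ≤ B := by linarith [hb.one_le]
  have h1 : |P.dm (F.th x t) * F.q x t ^ 2| ≤ B * F.q x t ^ 2 := by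
    rw [abs_mul, abs_of_nonneg (sq_nonneg (F.q x t))]
    exact mul_le_mul_of_nonneg_right (hb.abs_dm _) (sq_nonneg _)
  have h2 : |(P.m (F.th x t) * (P.dk (F.th x t) / 2)
      - (P.dm (F.th x t) * P.k (F.th x t) + P.m (F.th x t) * P.dk (F.th x t))) * F.p x t ^ 2| ≤
      B * F.p x t ^ 2 := by
    rw [abs_mul, abs_of_nonneg (sq_nonneg (F.p x t))]
    exact mul_le_mul_of_nonneg_right (hb.abs_pp _) (sq_nonneg _)
  have h3 : |P.γ₁ * P.m (F.th x t) * F.q x t| ≤ B * |F.q x t| := by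
    rw [abs_mul]
    exact mul_le_mul_of_nonneg_right (hb.abs_γm _) (abs_nonneg _)
  have h4 : |(P.dm (F.th x t) * P.h (F.th x t) + P.m (F.th x t) * P.dh (F.th x t)) * F.p x t
      * F.u x t| ≤ B * ((F.p x t ^ 2 + F.u x t ^ 2) / 2) := by
    rw [mul_assoc, abs_mul, abs_mul (F.p x t)]
    refine mul_le_mul (hb.abs_pu _) ?_ (by positivity) hB
    have := two_mul_le_add_sq |F.p x t| |F.u x t|
    rw [sq_abs, sq_abs] at this
    linarith
  have h5 : |F.Q x t| ≤ B * F.q x t ^ 2 + B * F.p x t ^ 2 + B * |F.q x t|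
      + B * ((F.p x t ^ 2 + F.u x t ^ 2) / 2) := by
    unfold Q
    refine (abs_add_le _ _).trans (add_le_add ((abs_sub _ _).trans (add_le_add
      ((abs_add_le _ _).trans (add_le_add h1 h2)) h3)) h4)
  have h6 : F.q x t ^ 2 + F.p x t ^ 2 + (F.p x t ^ 2 + F.u x t ^ 2) / 2 ≤
      2 * (1 + 1 / lam) * F.e x t := by
    have k1 : F.q x t ^ 2 + F.u x t ^ 2 ≤ F.e x t := by
      have := mul_nonneg (P.k_pos (F.th x t)).le (sq_nonneg (F.p x t))
      unfold e; linarith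
    have k2 : F.p x t ^ 2 ≤ F.e x t / lam := by
      rw [le_div_iff₀ hlam]
      have := F.k_mul_sq_le_e x t
      have := mul_le_mul_of_nonneg_right (hb.le_k (F.th x t)) (sq_nonneg (F.p x t))
      linarith
    have k3 : 2 * (1 + 1 / lam) * F.e x t = 2 * F.e x t + 2 * (F.e x t / lam) := by ring
    have := F.e_nonneg x t
    have : 0 ≤ F.e x t / lam := by positivity
    nlinarith [sq_nonneg (F.q x t), sq_nonneg (F.u x t)]
  have h7 := mul_le_mul_of_nonneg_left h6 hB
  linarith

end Flow

/-! ### The right-hand side at a fixed time -/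

/-- The test function `cutoff * heatKernel`. -/
def test (ρ σ y : ℝ) : ℝ := cutoff ρ y * heatKernel σ y

/-- The first space derivative of the test function. -/
def test₁ (ρ σ y : ℝ) : ℝ := cutoff₁ ρ y * heatKernel σ y + cutoff ρ y * heatKernel₁ σ y

/-- The second space derivative of the test function. -/
def test₂ (ρ σ y : ℝ) : ℝ :=
  cutoff₂ ρ y * heatKernel σ y + 2 * (cutoff₁ ρ y * heatKernel₁ σ y)
    + cutoff ρ y * heatKernel₂ σ y

theorem hasDerivAt_test {ρ : ℝ} (hρ : 0 < ρ) (σ y : ℝ) :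
    HasDerivAt (test ρ σ) (test₁ ρ σ y) y :=
  (hasDerivAt_cutoff hρ y).mul (hasDerivAt_heatKernel σ y)

theorem hasDerivAt_test₁ {ρ σ : ℝ} (hρ : 0 < ρ) (hσ : σ ≠ 0) (y : ℝ) :
    HasDerivAt (test₁ ρ σ) (test₂ ρ σ y) y := by
  refine (((hasDerivAt_cutoff₁ hρ y).mul (hasDerivAt_heatKernel σ y)).add
    ((hasDerivAt_cutoff hρ y).mul (hasDerivAt_heatKernel₁ hσ y))).congr_deriv ?_
  rw [test₂]; ring

theorem continuous_heatKernel (σ : ℝ) : Continuous (heatKernel σ) := by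
  unfold heatKernel; fun_prop
theorem continuous_heatKernel₁ (σ : ℝ) : Continuous (heatKernel₁ σ) := by
  have := continuous_heatKernel σ
  unfold heatKernel₁; fun_prop
theorem continuous_heatKernel₂ (σ : ℝ) : Continuous (heatKernel₂ σ) := by
  have := continuous_heatKernel σ
  unfold heatKernel₂; fun_prop

/-- Pointwise bound for the integrand of the weak form. The singular second derivative of the heat
kernel is multiplied by the Hölder increment of `g(θ)`; the derivatives of the cutoff gain a power
of the distance to the centre. -/
theorem integrand_le {s ρ y g g₀ J G Q H M B : ℝ} (hs : 0 < s) (hρ : 0 < ρ) (hy : |y| ≤ ρ)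
    (hH : |g - g₀| ≤ H * √|y|) (hJ : |J| ≤ M) (hg : |g| ≤ B) (hH0 : 0 ≤ H) :
    |(-g₀ * (cutoff ρ y * heatKernel₂ (s ^ 4) y) + g * test₂ ρ (s ^ 4) y) * J
        - test₁ ρ (s ^ 4) y * G + test ρ (s ^ 4) y * Q| ≤
      100 * H * M / s ^ 5 * gauss s y + 40 * B / (ρ ^ 2 * s ^ 2) * (gauss s y * |J|)
        + (4 / (ρ * s ^ 2) + 1 / s ^ 4) * (gauss s y * |G|)
        + 1 / s ^ 2 * (gauss s y * |Q|) := by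
  have hM : 0 ≤ M := (abs_nonneg _).trans hJ
  have hB : 0 ≤ B := (abs_nonneg _).trans hg
  have hη := gauss_pos s y
  have χ0 := cutoff_nonneg ρ y
  have χ1 := cutoff_le_one hρ hy
  have d1 := abs_cutoff₁_le hρ hy
  have d2 := abs_cutoff₂_le hρ hy
  have k0 := heatKernel_le hs y
  have k0' := heatKernel_nonneg (s ^ 4) y
  have k1 := abs_heatKernel₁_le hs y
  have k1' := abs_mul_heatKernel₁_le hs y
  have k2 := sqrt_abs_mul_heatKernel₂_le hs y
  have d1' : |cutoff₁ ρ y| ≤ 4 / ρ := d1.trans (by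
    rw [div_mul_eq_mul_div, div_le_div_iff₀ (by positivity) hρ]; nlinarith)
  have t1 : |(g - g₀) * (cutoff ρ y * heatKernel₂ (s ^ 4) y) * J| ≤
      100 * H * M / s ^ 5 * gauss s y := by
    rw [abs_mul, abs_mul, abs_mul, abs_of_nonneg χ0]
    calc |g - g₀| * (cutoff ρ y * |heatKernel₂ (s ^ 4) y|) * |J|
        ≤ (H * √|y|) * (1 * |heatKernel₂ (s ^ 4) y|) * M := by gcongr
      _ = H * M * (√|y| * |heatKernel₂ (s ^ 4) y|) := by ring
      _ ≤ H * M * (100 * (gauss s y / s ^ 5)) := by gcongr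
      _ = _ := by ring
  have t2 : |g * (cutoff₂ ρ y * heatKernel (s ^ 4) y
      + 2 * (cutoff₁ ρ y * heatKernel₁ (s ^ 4) y)) * J| ≤
      40 * B / (ρ ^ 2 * s ^ 2) * (gauss s y * |J|) := by
    rw [abs_mul, abs_mul]
    have a1 : |cutoff₂ ρ y * heatKernel (s ^ 4) y| ≤ 8 / ρ ^ 2 * (gauss s y / s ^ 2) := by
      rw [abs_mul, abs_of_nonneg k0']; gcongr
    have a2 : |cutoff₁ ρ y * heatKernel₁ (s ^ 4) y| ≤ 16 / ρ ^ 2 * (gauss s y / s ^ 2) := by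
      rw [abs_mul]
      calc |cutoff₁ ρ y| * |heatKernel₁ (s ^ 4) y|
          ≤ 4 / ρ ^ 2 * |y| * |heatKernel₁ (s ^ 4) y| := by gcongr
        _ = 4 / ρ ^ 2 * (|y| * |heatKernel₁ (s ^ 4) y|) := by ring
        _ ≤ 4 / ρ ^ 2 * (4 * (gauss s y / s ^ 2)) := by gcongr
        _ = _ := by ring
    have a3 : |cutoff₂ ρ y * heatKernel (s ^ 4) y + 2 * (cutoff₁ ρ y * heatKernel₁ (s ^ 4) y)| ≤
        40 / ρ ^ 2 * (gauss s y / s ^ 2) := by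
      refine (abs_add_le _ _).trans ?_
      rw [abs_mul 2, abs_two]
      have : 40 / ρ ^ 2 * (gauss s y / s ^ 2) =
        8 / ρ ^ 2 * (gauss s y / s ^ 2) + 2 * (16 / ρ ^ 2 * (gauss s y / s ^ 2)) := by ring
      linarith
    calc _ ≤ B * (40 / ρ ^ 2 * (gauss s y / s ^ 2)) * |J| := by gcongr
      _ = _ := by ring
  have t3 : |test₁ ρ (s ^ 4) y * G| ≤ (4 / (ρ * s ^ 2) + 1 / s ^ 4) * (gauss s y * |G|) := by
    rw [abs_mul, test₁]
    have a1 : |cutoff₁ ρ y * heatKernel (s ^ 4) y| ≤ 4 / ρ * (gauss s y / s ^ 2) := by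
      rw [abs_mul, abs_of_nonneg k0']; gcongr
    have a2 : |cutoff ρ y * heatKernel₁ (s ^ 4) y| ≤ 1 * (gauss s y / s ^ 4) := by
      rw [abs_mul, abs_of_nonneg χ0]; gcongr
    calc _ ≤ (4 / ρ * (gauss s y / s ^ 2) + 1 * (gauss s y / s ^ 4)) * |G| := by
          gcongr
          exact (abs_add_le _ _).trans (add_le_add a1 a2)
      _ = _ := by field_simp
  have t4 : |test ρ (s ^ 4) y * Q| ≤ 1 / s ^ 2 * (gauss s y * |Q|) := by
    rw [abs_mul, test, abs_mul, abs_of_nonneg χ0, abs_of_nonneg k0']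
    calc _ ≤ 1 * (gauss s y / s ^ 2) * |Q| := by gcongr
      _ = _ := by ring
  have e : (-g₀ * (cutoff ρ y * heatKernel₂ (s ^ 4) y) + g * test₂ ρ (s ^ 4) y) * J
        - test₁ ρ (s ^ 4) y * G + test ρ (s ^ 4) y * Q =
      (g - g₀) * (cutoff ρ y * heatKernel₂ (s ^ 4) y) * J
      + g * (cutoff₂ ρ y * heatKernel (s ^ 4) y
        + 2 * (cutoff₁ ρ y * heatKernel₁ (s ^ 4) y)) * J
      - test₁ ρ (s ^ 4) y * G + test ρ (s ^ 4) y * Q := by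
    rw [test₂]; ring
  rw [e]
  exact (abs_add_le _ _).trans (add_le_add ((abs_sub _ _).trans (add_le_add
    ((abs_add_le _ _).trans (add_le_add t1 t2)) t3)) t4)

/-- Collecting the powers of `s = σ ^ (1 / 4)` in the integrated bound, where `r` stands for `√E` and
`Y` for the integral of `J²`; the numerical constant is generous. The bound `s ≤ 2 B` reduces all
powers to `s⁻³`, except for the one multiplied by `√Y`, which is first split with the parameter `μ`:
only the square of `√Y` is integrable in time with a good bound, and that of `s⁻³` is not. -/
theorem slice_arith {B D r E N μ s ρ Y : ℝ} (hB : 1 ≤ B) (hD : 1 ≤ D) (hs : 0 < s)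
    (hsB : s ≤ 2 * B) (hρ : 0 < ρ) (hρ1 : ρ ≤ 1) (hμ : 0 < μ) (hr : 0 ≤ r) (hE : 0 ≤ E)
    (hN : 0 ≤ N) (hY : 0 ≤ Y) :
    100 * (2 * B * D * r) * (N / ρ ^ 2) / s ^ 5 * (6 * s ^ 2)
      + 40 * B / (ρ ^ 2 * s ^ 2) * (2 * s * √Y)
      + (4 / (ρ * s ^ 2) + 1 / s ^ 4) * B * (2 * s * (2 * D * r))
      + (4 / (ρ * s ^ 2) + 1 / s ^ 4) * B * (2 * s * (2 * D * r))
      + 1 / s ^ 2 * (2 * B * D) * (2 * E) + 1 / s ^ 2 * B * (2 * s * (2 * D * r)) ≤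
    1200 * B ^ 3 * D / ρ ^ 2 * ((r * N + r + E + μ) / s ^ 3 + Y / μ) := by
  have hB0 : 0 < B := by linarith
  have hD0 : 0 < D := by linarith
  set i := 1 / s ^ 3 with hi
  set w := 1 / ρ ^ 2 with hw
  have hi0 : 0 ≤ i := by positivity
  have hw1 : 1 ≤ w := by
    rw [hw, le_div_iff₀ (by positivity)]; nlinarith
  have hw2 : 1 / ρ ≤ w := by
    rw [hw]; exact one_div_le_one_div_of_le (by positivity) (by nlinarith)
  have h2 : 1 / s ^ 2 ≤ 2 * B * i := by
    rw [hi, mul_one_div, div_le_div_iff₀ (by positivity) (by positivity)]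
    nlinarith [mul_le_mul_of_nonneg_right hsB (sq_nonneg s)]
  have h1 : 1 / s ≤ 4 * B ^ 2 * i := by
    rw [hi, mul_one_div, div_le_div_iff₀ (by positivity) (by positivity)]
    have : s ^ 2 ≤ (2 * B) ^ 2 := pow_le_pow_left₀ hs.le hsB 2
    nlinarith [mul_le_mul_of_nonneg_right this hs.le]
  have hB1 : B ≤ B ^ 3 := by nlinarith [sq_nonneg (B - 1), mul_pos hB0 hB0]
  have hB2 : B ^ 2 ≤ B ^ 3 := by nlinarith [mul_pos hB0 hB0]
  have a1 : 100 * (2 * B * D * r) * (N / ρ ^ 2) / s ^ 5 * (6 * s ^ 2) =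
      1200 * B * D * w * (r * N * i) := by
    rw [hi, hw]; field_simp; ring
  have a1' : 1200 * B * D * w * (r * N * i) ≤ 1200 * B ^ 3 * D * w * (r * N * i) := by gcongr
  have a2 : 40 * B / (ρ ^ 2 * s ^ 2) * (2 * s * √Y) = 80 * B * w * (√Y / s) := by
    rw [hw]; field_simp; ring
  have a2' : √Y / s ≤ 2 * B * (μ * i) + Y / μ := by
    have e1 : √Y / s ≤ μ * (1 / s ^ 2) + Y / μ := by
      have e2 : μ * (1 / s ^ 2) + Y / μ - √Y / s =
          (1 / μ) * ((√Y - μ / (2 * s)) ^ 2 + 3 * (μ / s) ^ 2 / 4) := by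
        conv_lhs => rw [← Real.sq_sqrt hY, Real.sqrt_sq (Real.sqrt_nonneg _)]
        field_simp
        ring
      have : 0 ≤ (1 / μ) * ((√Y - μ / (2 * s)) ^ 2 + 3 * (μ / s) ^ 2 / 4) := by positivity
      linarith
    nlinarith [mul_le_mul_of_nonneg_left h2 hμ.le]
  have a2'' : 80 * B * w * (√Y / s) ≤ 1200 * B ^ 3 * D * w * (μ * i + Y / μ) := by
    calc 80 * B * w * (√Y / s) ≤ 80 * B * w * (2 * B * (μ * i) + Y / μ) := by gcongr
      _ ≤ 80 * B * w * (2 * B * (μ * i) + 2 * B * (Y / μ)) := by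
          have : 0 ≤ Y / μ := by positivity
          gcongr
          nlinarith
      _ = 160 * B ^ 2 * 1 * w * (μ * i + Y / μ) := by ring
      _ ≤ 1200 * B ^ 3 * D * w * (μ * i + Y / μ) := by gcongr; norm_num
  have a3 : (4 / (ρ * s ^ 2) + 1 / s ^ 4) * B * (2 * s * (2 * D * r)) =
      4 * B * D * r * (4 * (1 / ρ) * (1 / s) + 1 * i) := by
    rw [hi]; field_simp; ring
  have a3' : 4 * B * D * r * (4 * (1 / ρ) * (1 / s) + 1 * i) ≤ 68 * B ^ 3 * D * w * (r * i) := by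
    calc 4 * B * D * r * (4 * (1 / ρ) * (1 / s) + 1 * i)
        ≤ 4 * B * D * r * (4 * w * (4 * B ^ 2 * i) + w * i) := by gcongr
      _ = (64 * B ^ 3 + 4 * B) * D * w * (r * i) := by ring
      _ ≤ 68 * B ^ 3 * D * w * (r * i) := by gcongr; linarith
  have a4 : 1 / s ^ 2 * (2 * B * D) * (2 * E) ≤ 1200 * B ^ 3 * D * w * (E * i) := by
    calc 1 / s ^ 2 * (2 * B * D) * (2 * E) ≤ (2 * B * i) * (2 * B * D) * (2 * E) := by gcongr
      _ = 8 * B ^ 2 * D * 1 * (E * i) := by ring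
      _ ≤ 1200 * B ^ 3 * D * w * (E * i) := by gcongr; norm_num
  have a5 : 1 / s ^ 2 * B * (2 * s * (2 * D * r)) ≤ 16 * B ^ 3 * D * w * (r * i) := by
    calc 1 / s ^ 2 * B * (2 * s * (2 * D * r)) = 4 * B * D * r * (1 / s) := by
          field_simp; ring
      _ ≤ 4 * B * D * r * (4 * B ^ 2 * i) := by gcongr
      _ = 16 * B ^ 3 * D * 1 * (r * i) := by ring
      _ ≤ _ := by gcongr
  have a6 : 0 ≤ B ^ 3 * D * w * (r * i) := by positivity
  have e : 1200 * B ^ 3 * D / ρ ^ 2 * ((r * N + r + E + μ) / s ^ 3 + Y / μ) =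
      1200 * B ^ 3 * D * w * (r * N * i) + 1200 * (B ^ 3 * D * w * (r * i))
      + 1200 * B ^ 3 * D * w * (E * i) + 1200 * B ^ 3 * D * w * (μ * i + Y / μ) := by
    rw [hi, hw]; ring
  rw [e, a1, a2, a3]
  linarith

namespace Flow

variable {P : Coeffs} {T : ℝ} (F : Flow P T) {lam B : ℝ}

/-- The bound for the right-hand side of the weak form at a fixed time, when the heat kernel has
variance parameter `s⁴`. The singularity `s⁻³ = σ ^ (-3 / 4)` is integrable in time. -/
theorem slice_le (hb : P.Bounds lam B) {E N μ s ρ x₀ t : ℝ} (hs : 0 < s)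
    (hsB : s ≤ 2 * B) (hρ : 0 < ρ) (hρ1 : ρ ≤ 1) (hμ : 0 < μ) (hE : 0 ≤ E) (hN : 0 ≤ N)
    (he : ∫ x in (x₀ - ρ)..(x₀ + ρ), F.e x t ≤ 2 * E)
    (hJ : ∀ x, |x - x₀| ≤ ρ → |F.J x t| ≤ N / ρ ^ 2) :
    |∫ x in (x₀ - ρ)..(x₀ + ρ), ((-P.g (F.th x₀ t) * (cutoff ρ (x - x₀)
          * heatKernel₂ (s ^ 4) (x - x₀)) + P.g (F.th x t) * test₂ ρ (s ^ 4) (x - x₀)) * F.J x t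
        - test₁ ρ (s ^ 4) (x - x₀) * F.G x t + test ρ (s ^ 4) (x - x₀) * F.Q x t)| ≤
      1200 * B ^ 3 * (1 + 1 / lam) / ρ ^ 2 * ((√E * N + √E + E + μ) / s ^ 3
        + (∫ x in (x₀ - ρ)..(x₀ + ρ), F.J x t ^ 2) / μ) := by
  have hab : x₀ - ρ ≤ x₀ + ρ := by linarith
  have hlam := hb.lam_pos
  have hB1 := hb.one_le
  have hB0 : 0 < B := by linarith
  have hD := hb.one_le_one_add
  have hp := sqrt_le_of_le hD hE (F.integral_sq_le_of_sq_le F.cont_p (by linarith) hab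
    (fun x => F.p_sq_le hb x t) he)
  have hone : ∀ x, F.e x t ≤ (1 + 1 / lam) * F.e x t := fun x =>
    le_mul_of_one_le_left (F.e_nonneg x t) hD
  have hu := sqrt_le_of_le hD hE (F.integral_sq_le_of_sq_le F.cont_u (by linarith) hab
    (fun x => (F.u_sq_le_e x t).trans (hone x)) he)
  have hq := sqrt_le_of_le hD hE (F.integral_sq_le_of_sq_le F.cont_q (by linarith) hab
    (fun x => (F.q_sq_le_e x t).trans (hone x)) he)
  set D := 1 + 1 / lam with hDdef
  set c₁ := 100 * (2 * B * D * √E) * (N / ρ ^ 2) / s ^ 5 with hc₁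
  set c₂ := 40 * B / (ρ ^ 2 * s ^ 2) with hc₂
  set c₃ := (4 / (ρ * s ^ 2) + 1 / s ^ 4) * B with hc₃
  set c₄ := 1 / s ^ 2 * (2 * B * D) with hc₄
  set c₅ := 1 / s ^ 2 * B with hc₅
  have p2 : 0 ≤ c₂ := by positivity
  have p3 : 0 ≤ c₃ := by positivity
  have p4 : 0 ≤ c₄ := by positivity
  have p5 : 0 ≤ c₅ := by positivity
  have p1 : 0 ≤ c₁ := by positivity
  have cη : Continuous fun x => gauss s (x - x₀) := (continuous_gauss s).comp (by fun_prop)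
  have sJ := continuous_slice_left F.cont_J t
  have sG := continuous_slice_left F.cont_G t
  have sQ := continuous_slice_left F.cont_Q t
  have sp := continuous_slice_left F.cont_p t
  have su := continuous_slice_left F.cont_u t
  have sq := continuous_slice_left F.cont_q t
  have se := continuous_slice_left F.cont_e t
  have sg := continuous_slice_left (f := fun x t => P.g (F.th x t)) F.cont_g t
  have t0 : Continuous fun x => test ρ (s ^ 4) (x - x₀) :=
    ((continuous_cutoff ρ).mul (continuous_heatKernel _)).comp (by fun_prop)
  have t1 : Continuous fun x => test₁ ρ (s ^ 4) (x - x₀) :=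
    (((continuous_cutoff₁ ρ).mul (continuous_heatKernel _)).add
      ((continuous_cutoff ρ).mul (continuous_heatKernel₁ _))).comp (by fun_prop)
  have t2 : Continuous fun x => test₂ ρ (s ^ 4) (x - x₀) :=
    ((((continuous_cutoff₂ ρ).mul (continuous_heatKernel _)).add
      (continuous_const.mul ((continuous_cutoff₁ ρ).mul (continuous_heatKernel₁ _)))).add
      ((continuous_cutoff ρ).mul (continuous_heatKernel₂ _))).comp (by fun_prop)
  have t3 : Continuous fun x => cutoff ρ (x - x₀) * heatKernel₂ (s ^ 4) (x - x₀) :=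
    ((continuous_cutoff ρ).mul (continuous_heatKernel₂ _)).comp
      (f := fun x => x - x₀) (by fun_prop)
  have hpt : ∀ x ∈ Icc (x₀ - ρ) (x₀ + ρ),
      |(-P.g (F.th x₀ t) * (cutoff ρ (x - x₀) * heatKernel₂ (s ^ 4) (x - x₀))
        + P.g (F.th x t) * test₂ ρ (s ^ 4) (x - x₀)) * F.J x t
        - test₁ ρ (s ^ 4) (x - x₀) * F.G x t + test ρ (s ^ 4) (x - x₀) * F.Q x t| ≤
      c₁ * gauss s (x - x₀) + c₂ * (gauss s (x - x₀) * |F.J x t|)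
        + c₃ * (gauss s (x - x₀) * |F.p x t|) + c₃ * (gauss s (x - x₀) * |F.u x t|)
        + c₄ * F.e x t + c₅ * (gauss s (x - x₀) * |F.q x t|) := fun x hx => by
    have hy : |x - x₀| ≤ ρ := abs_le.2 ⟨by linarith [hx.1], by linarith [hx.2]⟩
    have hη := gauss_pos s (x - x₀)
    refine (integrand_le hs hρ hy (F.abs_g_sub_le_sqrt hb hE he hy) (hJ x hy) (hb.abs_g _)
      (by positivity)).trans ?_
    have g1 : (4 / (ρ * s ^ 2) + 1 / s ^ 4) * (gauss s (x - x₀) * |F.G x t|) ≤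
        c₃ * (gauss s (x - x₀) * |F.p x t|) + c₃ * (gauss s (x - x₀) * |F.u x t|) := by
      calc _ ≤ (4 / (ρ * s ^ 2) + 1 / s ^ 4) *
            (gauss s (x - x₀) * (B * |F.p x t| + B * |F.u x t|)) := by
              gcongr; exact F.abs_G_le hb x t
        _ = _ := by rw [hc₃]; ring
    have g2 : 1 / s ^ 2 * (gauss s (x - x₀) * |F.Q x t|) ≤
        c₄ * F.e x t + c₅ * (gauss s (x - x₀) * |F.q x t|) := by
      have he0 := F.e_nonneg x t
      calc _ ≤ 1 / s ^ 2 * (gauss s (x - x₀) * (2 * B * D * F.e x t + B * |F.q x t|)) := by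
              gcongr; exact F.abs_Q_le hb x t
        _ = gauss s (x - x₀) * (c₄ * F.e x t) + c₅ * (gauss s (x - x₀) * |F.q x t|) := by
              rw [hc₄, hc₅]; ring
        _ ≤ _ := by
              exact add_le_add (mul_le_of_le_one_left (by positivity) (gauss_le_one _ _)) le_rfl
    linarith
  have i1 : IntervalIntegrable (fun x => c₁ * gauss s (x - x₀)) volume (x₀ - ρ) (x₀ + ρ) := by
    apply Continuous.intervalIntegrable; fun_prop
  have i2 : IntervalIntegrable (fun x => c₂ * (gauss s (x - x₀) * |F.J x t|)) volume
      (x₀ - ρ) (x₀ + ρ) := by apply Continuous.intervalIntegrable; fun_prop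
  have i3 : IntervalIntegrable (fun x => c₃ * (gauss s (x - x₀) * |F.p x t|)) volume
      (x₀ - ρ) (x₀ + ρ) := by apply Continuous.intervalIntegrable; fun_prop
  have i4 : IntervalIntegrable (fun x => c₃ * (gauss s (x - x₀) * |F.u x t|)) volume
      (x₀ - ρ) (x₀ + ρ) := by apply Continuous.intervalIntegrable; fun_prop
  have i5 : IntervalIntegrable (fun x => c₄ * F.e x t) volume
      (x₀ - ρ) (x₀ + ρ) := by apply Continuous.intervalIntegrable; fun_prop
  have i6 : IntervalIntegrable (fun x => c₅ * (gauss s (x - x₀) * |F.q x t|)) volume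
      (x₀ - ρ) (x₀ + ρ) := by apply Continuous.intervalIntegrable; fun_prop
  refine (intervalIntegral.abs_integral_le_integral_abs hab).trans ?_
  refine (intervalIntegral.integral_mono_on hab (by
    apply Continuous.intervalIntegrable; fun_prop)
    (((((i1.add i2).add i3).add i4).add i5).add i6) hpt).trans ?_
  rw [intervalIntegral.integral_add ((((i1.add i2).add i3).add i4).add i5) i6,
    intervalIntegral.integral_add (((i1.add i2).add i3).add i4) i5,
    intervalIntegral.integral_add ((i1.add i2).add i3) i4,
    intervalIntegral.integral_add (i1.add i2) i3, intervalIntegral.integral_add i1 i2]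
  simp only [intervalIntegral.integral_const_mul]
  refine le_trans ?_ (slice_arith hB1 hD hs hsB hρ hρ1 hμ (Real.sqrt_nonneg E) hE hN
    (intervalIntegral.integral_nonneg hab fun x _ => sq_nonneg (F.J x t)))
  have q1 := mul_le_mul_of_nonneg_left (integral_gauss_le hs x₀ hab) p1
  have q2 := mul_le_mul_of_nonneg_left (integral_gauss_mul_le hs x₀ hab sJ) p2
  have q3 := mul_le_mul_of_nonneg_left ((integral_gauss_mul_le hs x₀ hab sp).trans
    (mul_le_mul_of_nonneg_left hp (by positivity))) p3
  have q4 := mul_le_mul_of_nonneg_left ((integral_gauss_mul_le hs x₀ hab su).trans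
    (mul_le_mul_of_nonneg_left hu (by positivity))) p3
  have q5 := mul_le_mul_of_nonneg_left he p4
  have q6 := mul_le_mul_of_nonneg_left ((integral_gauss_mul_le hs x₀ hab sq).trans
    (mul_le_mul_of_nonneg_left hq (by positivity))) p5
  exact add_le_add (add_le_add (add_le_add (add_le_add (add_le_add q1 q2) q3) q4) q5) q6

end Flow

/-! ### Integration in time and absorption -/

namespace Flow

variable {P : Coeffs} {T : ℝ} (F : Flow P T) {lam B : ℝ}

/-- The variance of the backward heat kernel with pole at `(x₀, t₀)`, regularised by `δ`: the
viscosity is frozen in space at `x₀` but keeps its dependence on time, so that regularity of `θ` in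
time is not needed. Past `t₀` it is extended constantly. -/
def var (x₀ t₀ δ t : ℝ) : ℝ := δ + ∫ r in (min t t₀)..t₀, P.g (F.th x₀ r)

variable {x₀ t₀ δ : ℝ}

theorem cont_g_slice (x₀ : ℝ) : Continuous fun r => P.g (F.th x₀ r) :=
  continuous_slice_right (f := fun x t => P.g (F.th x t)) F.cont_g x₀

theorem continuous_var : Continuous (F.var x₀ t₀ δ) := by
  have h := intervalIntegral.continuous_primitive (μ := volume)
    (fun a b => (F.cont_g_slice x₀).intervalIntegrable a b) t₀
  have h2 : F.var x₀ t₀ δ = fun t => δ - ∫ r in t₀..(min t t₀), P.g (F.th x₀ r) := by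
    funext t
    rw [var, intervalIntegral.integral_symm, sub_eq_add_neg]
  rw [h2]
  exact continuous_const.sub (h.comp (continuous_id.min continuous_const))

theorem le_var (t : ℝ) : δ ≤ F.var x₀ t₀ δ t := by
  have : 0 ≤ ∫ r in (min t t₀)..t₀, P.g (F.th x₀ r) :=
    intervalIntegral.integral_nonneg (min_le_right _ _) fun r _ => (P.g_pos _).le
  unfold var
  linarith

theorem var_self : F.var x₀ t₀ δ t₀ = δ := by simp [var]

theorem var_le (hb : P.Bounds lam B) {t : ℝ} (ht : 0 ≤ t) (ht₀ : 0 ≤ t₀) (ht1 : t₀ ≤ 1)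
    (hδ : δ ≤ 1) : F.var x₀ t₀ δ t ≤ 2 * B := by
  have hB := hb.one_le
  have h1 : ∫ r in (min t t₀)..t₀, P.g (F.th x₀ r) ≤ ∫ r in (min t t₀)..t₀, B := by
    apply intervalIntegral.integral_mono_on (min_le_right _ _)
    · exact (F.cont_g_slice x₀).intervalIntegrable _ _
    · simp
    · exact fun r _ => (le_abs_self _).trans (hb.abs_g _)
  rw [intervalIntegral.integral_const, smul_eq_mul] at h1
  have h2 : 0 ≤ min t t₀ := le_min ht ht₀
  unfold var
  nlinarith

theorem hasDerivAt_var {t : ℝ} (ht : t < t₀) :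
    HasDerivAt (F.var x₀ t₀ δ) (-P.g (F.th x₀ t)) t := by
  have h1 : HasDerivAt (fun t => ∫ r in t..t₀, P.g (F.th x₀ r)) (-P.g (F.th x₀ t)) t :=
    intervalIntegral.integral_hasDerivAt_left ((F.cont_g_slice x₀).intervalIntegrable _ _)
      ((F.cont_g_slice x₀).stronglyMeasurableAtFilter _ _) (F.cont_g_slice x₀).continuousAt
  refine (h1.const_add δ).congr_of_eventuallyEq ?_
  filter_upwards [Iio_mem_nhds ht] with r hr
  rw [var, min_eq_left (le_of_lt hr)]

theorem sqrt_sqrt_pow_four {σ : ℝ} (hσ : 0 ≤ σ) : √(√σ) ^ 4 = σ := by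
  rw [show √(√σ) ^ 4 = (√(√σ) ^ 2) ^ 2 by ring, Real.sq_sqrt (Real.sqrt_nonneg _),
    Real.sq_sqrt hσ]

/-- The singular weight `σ ^ (-3 / 4)` is, up to `-σ'`, the derivative of `4 σ ^ (1 / 4)`. -/
theorem integral_inv_var_le (hb : P.Bounds lam B) (ht₀ : 0 ≤ t₀) (ht1 : t₀ ≤ 1) (hδ : 0 < δ)
    (hδ1 : δ ≤ 1) : ∫ t in (0)..t₀, 1 / √(√(F.var x₀ t₀ δ t)) ^ 3 ≤ 8 * B / lam := by
  have hlam := hb.lam_pos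
  have hσ : ∀ t, 0 < F.var x₀ t₀ δ t := fun t => hδ.trans_le (F.le_var t)
  have hs : ∀ t, 0 < √(√(F.var x₀ t₀ δ t)) := fun t =>
    Real.sqrt_pos.2 (Real.sqrt_pos.2 (hσ t))
  have cs : Continuous fun t => √(√(F.var x₀ t₀ δ t)) := F.continuous_var.sqrt.sqrt
  have cg := F.cont_g_slice x₀
  have c1 : Continuous fun t => 1 / √(√(F.var x₀ t₀ δ t)) ^ 3 :=
    continuous_const.div (cs.pow 3) fun t => (pow_pos (hs t) 3).ne'
  have c2 : Continuous fun t => P.g (F.th x₀ t) * (1 / √(√(F.var x₀ t₀ δ t)) ^ 3) := cg.mul c1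
  have h1 : ∫ t in (0)..t₀, P.g (F.th x₀ t) * (1 / √(√(F.var x₀ t₀ δ t)) ^ 3) =
      -4 * √(√(F.var x₀ t₀ δ t₀)) - -4 * √(√(F.var x₀ t₀ δ 0)) := by
    refine intervalIntegral.integral_eq_sub_of_hasDerivAt_of_le ht₀
      (continuous_const.mul cs).continuousOn (fun t ht => ?_) (c2.intervalIntegrable _ _)
    have := (((F.hasDerivAt_var (δ := δ) (x₀ := x₀) ht.2).sqrt (hσ t).ne').sqrt
      (Real.sqrt_pos.2 (hσ t)).ne').const_mul (-4)
    refine this.congr_deriv ?_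
    have e1 : √(F.var x₀ t₀ δ t) = √(√(F.var x₀ t₀ δ t)) ^ 2 :=
      (Real.sq_sqrt (Real.sqrt_nonneg _)).symm
    have := hs t
    rw [e1, Real.sqrt_sq (hs t).le]
    field_simp
    ring
  have h2 : √(√(F.var x₀ t₀ δ 0)) ≤ 2 * B := by
    have hB := hb.one_le
    refine Real.sqrt_le_iff.2 ⟨by linarith, Real.sqrt_le_iff.2 ⟨by positivity, ?_⟩⟩
    refine (F.var_le hb le_rfl ht₀ ht1 hδ1).trans ?_
    nlinarith [pow_le_pow_left₀ (by norm_num) hB 3]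
  have h3 : lam * ∫ t in (0)..t₀, 1 / √(√(F.var x₀ t₀ δ t)) ^ 3 ≤
      ∫ t in (0)..t₀, P.g (F.th x₀ t) * (1 / √(√(F.var x₀ t₀ δ t)) ^ 3) := by
    rw [← intervalIntegral.integral_const_mul]
    apply intervalIntegral.integral_mono_on ht₀
    · exact (c1.const_mul _).intervalIntegrable _ _
    · exact c2.intervalIntegrable _ _
    · exact fun t _ => mul_le_mul_of_nonneg_right (hb.le_g _)
        (one_div_nonneg.2 (pow_pos (hs t) 3).le)
  rw [le_div_iff₀ hlam]
  have := hs t₀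
  linarith

/-- The bound for `J` at the centre of a window of radius `ρ` in terms of a crude bound `N / ρ²` on
the window, which enters with the small factor `√E`. -/
theorem pointwise_le (hb : P.Bounds lam B) (hT1 : T ≤ 1) {E N μ ρ W j₀ : ℝ} (hρ : 0 < ρ)
    (hρ1 : ρ ≤ 1) (hμ : 0 < μ) (hE : 0 ≤ E) (hN : 0 ≤ N) (ht₀ : t₀ ∈ Icc 0 T)
    (he : ∀ t ∈ Icc 0 T, ∫ x in (x₀ - ρ)..(x₀ + ρ), F.e x t ≤ 2 * E)
    (hJ : ∀ t ∈ Icc 0 T, ∀ x, |x - x₀| ≤ ρ → |F.J x t| ≤ N / ρ ^ 2)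
    (hW : ∫ t in (0)..t₀, ∫ x in (x₀ - ρ)..(x₀ + ρ), F.J x t ^ 2 ≤ W)
    (hj₀ : ∀ x, |F.J x 0| ≤ j₀) :
    √(Real.pi * 4) * |F.J x₀ t₀| ≤ √(Real.pi * 4) * j₀ +
      1200 * B ^ 3 * (1 + 1 / lam) / ρ ^ 2 * ((√E * N + √E + E + μ) * (8 * B / lam) + W / μ) := by
  have hlam := hb.lam_pos
  have hB1 := hb.one_le
  have hB0 : 0 < B := by linarith
  have hab : x₀ - ρ ≤ x₀ + ρ := by linarith
  have ht1 : t₀ ≤ 1 := ht₀.2.trans hT1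
  have hj : 0 ≤ j₀ := (abs_nonneg _).trans (hj₀ 0)
  have key : ∀ δ : ℝ, 0 < δ → δ ≤ 1 →
      |∫ x in (x₀ - ρ)..(x₀ + ρ), heatKernel δ (x - x₀) * (cutoff ρ (x - x₀) * F.J x t₀)| ≤
      √(Real.pi * 4) * j₀ + 1200 * B ^ 3 * (1 + 1 / lam) / ρ ^ 2 *
        ((√E * N + √E + E + μ) * (8 * B / lam) + W / μ) := fun δ hδ hδ1 => by
    obtain ⟨σ, hσdef⟩ : ∃ σ, σ = F.var x₀ t₀ δ := ⟨_, rfl⟩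
    have hσ : ∀ t, 0 < σ t := fun t => by rw [hσdef]; exact hδ.trans_le (F.le_var t)
    have cσ₀ : Continuous σ := by rw [hσdef]; exact F.continuous_var
    have hσt : ∀ t < t₀, HasDerivAt σ (-P.g (F.th x₀ t)) t := fun t ht => by
      rw [hσdef]; exact F.hasDerivAt_var ht
    have hσle : ∀ t, 0 ≤ t → σ t ≤ 2 * B := fun t ht => by
      rw [hσdef]; exact F.var_le hb ht ht₀.1 ht1 hδ1
    have cσ : Continuous fun y : ℝ × ℝ => σ y.2 := cσ₀.comp continuous_snd
    have cK : Continuous fun y : ℝ × ℝ => heatKernel (σ y.2) (y.1 - x₀) := by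
      unfold heatKernel
      refine Continuous.div ?_ cσ.sqrt fun y => (Real.sqrt_pos.2 (hσ y.2)).ne'
      refine (Continuous.div (by fun_prop) (by fun_prop) fun y => ?_).neg.rexp
      have := hσ y.2
      positivity
    have cK₁ : Continuous fun y : ℝ × ℝ => heatKernel₁ (σ y.2) (y.1 - x₀) := by
      unfold heatKernel₁
      refine (Continuous.div (by fun_prop) (by fun_prop) fun y => ?_).neg.mul cK
      have := hσ y.2
      positivity
    have cK₂ : Continuous fun y : ℝ × ℝ => heatKernel₂ (σ y.2) (y.1 - x₀) := by
      unfold heatKernel₂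
      refine ((Continuous.div (by fun_prop) (by fun_prop) fun y => ?_).sub
        (Continuous.div (by fun_prop) (by fun_prop) fun y => ?_)).mul cK <;>
      · have := hσ y.2
        positivity
    have cχ : Continuous fun y : ℝ × ℝ => cutoff ρ (y.1 - x₀) :=
      (continuous_cutoff ρ).comp (by fun_prop)
    have cχ₁ : Continuous fun y : ℝ × ℝ => cutoff₁ ρ (y.1 - x₀) :=
      (continuous_cutoff₁ ρ).comp (by fun_prop)
    have cχ₂ : Continuous fun y : ℝ × ℝ => cutoff₂ ρ (y.1 - x₀) :=
      (continuous_cutoff₂ ρ).comp (by fun_prop)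
    have cg0 : Continuous fun y : ℝ × ℝ => P.g (F.th x₀ y.2) :=
      (F.cont_g_slice x₀).comp continuous_snd
    have cJ := F.cont_J
    have cG := F.cont_G
    have cQ := F.cont_Q
    have cg := F.cont_g
    have cφ : Continuous fun y : ℝ × ℝ => test ρ (σ y.2) (y.1 - x₀) := by
      unfold test; fun_prop
    have cφx : Continuous fun y : ℝ × ℝ => test₁ ρ (σ y.2) (y.1 - x₀) := by
      unfold test₁; fun_prop
    have cφxx : Continuous fun y : ℝ × ℝ => test₂ ρ (σ y.2) (y.1 - x₀) := by
      unfold test₂; fun_prop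
    have cφt : Continuous fun y : ℝ × ℝ => -P.g (F.th x₀ y.2) *
        (cutoff ρ (y.1 - x₀) * heatKernel₂ (σ y.2) (y.1 - x₀)) := by fun_prop
    -- the test function vanishes to first order at the ends of the window
    have χa : ∀ z : ℝ, z = ρ ∨ z = -ρ → cutoff ρ z = 0 ∧ cutoff₁ ρ z = 0 := fun z hz => by
      have : (z / ρ) ^ 2 = 1 := by
        rcases hz with rfl | rfl
        · rw [div_self hρ.ne', one_pow]
        · rw [neg_div, div_self hρ.ne']; norm_num
      constructor
      · rw [cutoff, this]; norm_num
      · rw [cutoff₁, this]; norm_num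
    have ea : x₀ - ρ - x₀ = ρ ∨ x₀ - ρ - x₀ = -ρ := Or.inr (by ring)
    have eb : x₀ + ρ - x₀ = ρ ∨ x₀ + ρ - x₀ = -ρ := Or.inl (by ring)
    have weak := F.weak_form hab ht₀ (φ := fun x t => test ρ (σ t) (x - x₀))
      (φx := fun x t => test₁ ρ (σ t) (x - x₀)) (φxx := fun x t => test₂ ρ (σ t) (x - x₀))
      (φt := fun x t => -P.g (F.th x₀ t) *
        (cutoff ρ (x - x₀) * heatKernel₂ (σ t) (x - x₀))) cφ cφx cφxx cφt
      (fun x t => by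
        exact (hasDerivAt_test hρ (σ t) (x - x₀)).comp_sub_const x x₀)
      (fun x t => by
        exact (hasDerivAt_test₁ hρ (hσ t).ne' (x - x₀)).comp_sub_const x x₀)
      (fun x t ht => by
        have := ((hasDerivAt_heatKernel_time (hσ t) (x - x₀)).comp t
          (hσt t ht.2)).const_mul (cutoff ρ (x - x₀))
        exact this.congr_deriv (by ring))
      (fun t => by simp only [test, (χa _ ea).1, zero_mul])
      (fun t => by simp only [test, (χa _ eb).1, zero_mul])
      (fun t => by simp only [test₁, (χa _ ea).1, (χa _ ea).2, zero_mul, add_zero])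
      (fun t => by simp only [test₁, (χa _ eb).1, (χa _ eb).2, zero_mul, add_zero])
    have hinit : |∫ x in (x₀ - ρ)..(x₀ + ρ), test ρ (σ 0) (x - x₀) * F.J x 0| ≤
        √(Real.pi * 4) * j₀ := by
      have s0 := continuous_slice_left cJ 0
      have s1 : Continuous fun x => test ρ (σ 0) (x - x₀) :=
        continuous_slice_left (f := fun x t => test ρ (σ t) (x - x₀)) cφ 0
      have s2 : Continuous fun x => heatKernel (σ 0) (x - x₀) :=
        continuous_slice_left (f := fun x t => heatKernel (σ t) (x - x₀)) cK 0
      calc _ ≤ ∫ x in (x₀ - ρ)..(x₀ + ρ), |test ρ (σ 0) (x - x₀) * F.J x 0| :=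
            intervalIntegral.abs_integral_le_integral_abs hab
        _ ≤ ∫ x in (x₀ - ρ)..(x₀ + ρ), heatKernel (σ 0) (x - x₀) * j₀ := by
            apply intervalIntegral.integral_mono_on hab
            · apply Continuous.intervalIntegrable; fun_prop
            · apply Continuous.intervalIntegrable; fun_prop
            · intro x hx
              have hy : |x - x₀| ≤ ρ := abs_le.2 ⟨by linarith [hx.1], by linarith [hx.2]⟩
              rw [abs_mul, test, abs_mul, abs_of_nonneg (cutoff_nonneg _ _),
                abs_of_nonneg (heatKernel_nonneg _ _)]
              exact mul_le_mul (mul_le_of_le_one_left (heatKernel_nonneg _ _)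
                (cutoff_le_one hρ hy)) (hj₀ x) (abs_nonneg _) (heatKernel_nonneg _ _)
        _ = (∫ x in (x₀ - ρ)..(x₀ + ρ), heatKernel (σ 0) (x - x₀)) * j₀ :=
            intervalIntegral.integral_mul_const _ _
        _ ≤ _ := mul_le_mul_of_nonneg_right (integral_heatKernel_le (hσ 0) x₀ hab) hj
    have hfin : ∫ x in (x₀ - ρ)..(x₀ + ρ),
        heatKernel δ (x - x₀) * (cutoff ρ (x - x₀) * F.J x t₀) =
        ∫ x in (x₀ - ρ)..(x₀ + ρ), test ρ (σ t₀) (x - x₀) * F.J x t₀ := by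
      congr 1
      funext x
      rw [hσdef, F.var_self, test]
      ring
    -- the space integrals on the right-hand side of the weak form, as functions of time
    set I : ℝ → ℝ := fun t => ∫ x in (x₀ - ρ)..(x₀ + ρ),
      ((-P.g (F.th x₀ t) * (cutoff ρ (x - x₀) * heatKernel₂ (σ t) (x - x₀))
        + P.g (F.th x t) * test₂ ρ (σ t) (x - x₀)) * F.J x t
        - test₁ ρ (σ t) (x - x₀) * F.G x t + test ρ (σ t) (x - x₀) * F.Q x t) with hI
    set Y : ℝ → ℝ := fun t => ∫ x in (x₀ - ρ)..(x₀ + ρ), F.J x t ^ 2 with hYdef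
    have hs : ∀ t, 0 < √(√(σ t)) := fun t => Real.sqrt_pos.2 (Real.sqrt_pos.2 (hσ t))
    set A := 1200 * B ^ 3 * (1 + 1 / lam) / ρ ^ 2 with hA
    have hA0 : 0 ≤ A := by positivity
    set L := √E * N + √E + E + μ with hL
    have hL0 : 0 ≤ L := by positivity
    have hslice : ∀ t ∈ Icc 0 t₀, |I t| ≤ A * (L * (1 / √(√(σ t)) ^ 3) + Y t / μ) :=
      fun t ht => by
      have htT : t ∈ Icc 0 T := ⟨ht.1, ht.2.trans ht₀.2⟩
      have hsB : √(√(σ t)) ≤ 2 * B := by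
        refine Real.sqrt_le_iff.2 ⟨by linarith, Real.sqrt_le_iff.2 ⟨by positivity, ?_⟩⟩
        refine (hσle t ht.1).trans ?_
        nlinarith [pow_le_pow_left₀ (by norm_num) hB1 3]
      have := F.slice_le hb (hs t) hsB hρ hρ1 hμ hE hN (he t htT) (hJ t htT)
      rw [sqrt_sqrt_pow_four (hσ t).le] at this
      rw [mul_one_div]
      exact this
    have cI : Continuous I := continuous_integral_slice
      (f := fun x t => (-P.g (F.th x₀ t) * (cutoff ρ (x - x₀) * heatKernel₂ (σ t) (x - x₀))
        + P.g (F.th x t) * test₂ ρ (σ t) (x - x₀)) * F.J x t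
        - test₁ ρ (σ t) (x - x₀) * F.G x t + test ρ (σ t) (x - x₀) * F.Q x t)
      (by fun_prop) _ _
    have cY : Continuous Y := continuous_integral_slice (f := fun x t => F.J x t ^ 2)
      (by fun_prop) _ _
    have cs : Continuous fun t => 1 / √(√(σ t)) ^ 3 :=
      continuous_const.div (cσ₀.sqrt.sqrt.pow 3) fun t => (pow_pos (hs t) 3).ne'
    have hint : |∫ t in (0)..t₀, I t| ≤ A * (L * (8 * B / lam) + W / μ) := by
      calc |∫ t in (0)..t₀, I t| ≤ ∫ t in (0)..t₀, |I t| :=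
            intervalIntegral.abs_integral_le_integral_abs ht₀.1
        _ ≤ ∫ t in (0)..t₀, A * (L * (1 / √(√(σ t)) ^ 3) + Y t / μ) := by
            apply intervalIntegral.integral_mono_on ht₀.1
            · exact cI.abs.intervalIntegrable _ _
            · apply Continuous.intervalIntegrable; fun_prop
            · exact hslice
        _ = A * (L * (∫ t in (0)..t₀, 1 / √(√(σ t)) ^ 3) + (∫ t in (0)..t₀, Y t) / μ) := by
            rw [intervalIntegral.integral_const_mul, intervalIntegral.integral_add
              ((cs.const_mul _).intervalIntegrable _ _) ((cY.div_const _).intervalIntegrable _ _),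
              intervalIntegral.integral_const_mul, intervalIntegral.integral_div]
        _ ≤ _ := by
            have := F.integral_inv_var_le (x₀ := x₀) hb ht₀.1 ht1 hδ hδ1
            rw [← hσdef] at this
            gcongr
    rw [hfin, eq_add_of_sub_eq weak, add_comm]
    exact (abs_add_le _ _).trans (add_le_add hinit hint)
  have sJ := continuous_slice_left F.cont_J t₀
  have cχ : Continuous fun x => cutoff ρ (x - x₀) := (continuous_cutoff ρ).comp (by fun_prop)
  -- as `δ → 0` the left-hand side of `key` tends to `2 √π |J(x₀, t₀)|`, the right-hand side is fixed
  have lim := (tendsto_integral_heatKernel (f := fun x => cutoff ρ (x - x₀) * F.J x t₀)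
    (by fun_prop) x₀ hρ).abs
  have hχ0 : cutoff ρ (x₀ - x₀) = 1 := by simp [cutoff]
  rw [hχ0, one_mul, abs_mul, abs_of_nonneg (Real.sqrt_nonneg _)] at lim
  refine le_of_tendsto lim ?_
  filter_upwards [Ioc_mem_nhdsGT (zero_lt_one' ℝ)] with δ hδ
  exact key δ hδ.1 hδ.2

/-- The space-time `L²` norm of `J` on a unit window is controlled by the energy and its
dissipation. -/
theorem integral_J_sq_le (hb : P.Bounds lam B) (hT1 : T ≤ 1) {E : ℝ} (hE : 0 ≤ E) {a b : ℝ}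
    (hab : a ≤ b) (ht₀ : t₀ ∈ Icc 0 T) (he : ∀ t ∈ Icc 0 T, ∫ x in a..b, F.e x t ≤ 2 * E)
    (hv : lam / 2 * ∫ t in (0)..t₀, ∫ x in a..b, F.v x t ^ 2 ≤ E) :
    ∫ t in (0)..t₀, ∫ x in a..b, F.J x t ^ 2 ≤ 4 * B ^ 2 * (1 + 1 / lam) * E := by
  have hlam := hb.lam_pos
  have hB := hb.one_le
  have cv := F.cont_v
  have ce := F.cont_e
  have cJ := F.cont_J
  have h1 : ∀ t, ∫ x in a..b, F.J x t ^ 2 ≤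
      2 * (∫ x in a..b, F.v x t ^ 2) + 2 * B ^ 2 * ∫ x in a..b, F.e x t := fun t => by
    have sv := continuous_slice_left cv t
    have se := continuous_slice_left ce t
    have sJ := continuous_slice_left cJ t
    rw [← intervalIntegral.integral_const_mul, ← intervalIntegral.integral_const_mul,
      ← intervalIntegral.integral_add]
    · apply intervalIntegral.integral_mono_on hab
      · apply Continuous.intervalIntegrable; fun_prop
      · apply Continuous.intervalIntegrable; fun_prop
      · intro x _
        have h2 : F.J x t ^ 2 ≤ 2 * F.v x t ^ 2 + 2 * (P.m (F.th x t) * F.q x t) ^ 2 := by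
          unfold J
          nlinarith [sq_nonneg (F.v x t - P.m (F.th x t) * F.q x t)]
        have h3 : P.m (F.th x t) ^ 2 ≤ B ^ 2 := by
          rw [sq_le_sq, abs_of_pos (by linarith : 0 < B)]; exact hb.abs_m _
        have h4 := mul_le_mul h3 (F.q_sq_le_e x t) (sq_nonneg _) (sq_nonneg B)
        rw [mul_pow] at h2
        linarith
    · apply Continuous.intervalIntegrable; fun_prop
    · apply Continuous.intervalIntegrable; fun_prop
  have c1 := continuous_integral_slice (f := fun x t => F.v x t ^ 2) (by fun_prop) a b
  have c2 := continuous_integral_slice ce a b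
  have c3 := continuous_integral_slice (f := fun x t => F.J x t ^ 2) (by fun_prop) a b
  have h5 : ∫ t in (0)..t₀, ∫ x in a..b, F.e x t ≤ 2 * E := by
    calc _ ≤ ∫ t in (0)..t₀, 2 * E := by
          apply intervalIntegral.integral_mono_on ht₀.1
          · exact c2.intervalIntegrable _ _
          · simp
          · exact fun t ht => he t ⟨ht.1, ht.2.trans ht₀.2⟩
      _ = t₀ * (2 * E) := by rw [intervalIntegral.integral_const, smul_eq_mul, sub_zero]
      _ ≤ 2 * E := mul_le_of_le_one_left (by positivity) (ht₀.2.trans hT1)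
  have h6 : ∫ t in (0)..t₀, ∫ x in a..b, F.v x t ^ 2 ≤ 2 * E / lam := by
    rw [le_div_iff₀ hlam]; linarith
  calc ∫ t in (0)..t₀, ∫ x in a..b, F.J x t ^ 2
      ≤ ∫ t in (0)..t₀,
        (2 * (∫ x in a..b, F.v x t ^ 2) + 2 * B ^ 2 * ∫ x in a..b, F.e x t) := by
        apply intervalIntegral.integral_mono_on ht₀.1
        · exact c3.intervalIntegrable _ _
        · exact ((c1.const_mul _).add (c2.const_mul _)).intervalIntegrable _ _
        · exact fun t _ => h1 t
    _ = 2 * (∫ t in (0)..t₀, ∫ x in a..b, F.v x t ^ 2)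
        + 2 * B ^ 2 * ∫ t in (0)..t₀, ∫ x in a..b, F.e x t := by
        rw [intervalIntegral.integral_add ((c1.const_mul _).intervalIntegrable _ _)
          ((c2.const_mul _).intervalIntegrable _ _), intervalIntegral.integral_const_mul,
          intervalIntegral.integral_const_mul]
    _ ≤ 2 * (2 * E / lam) + 2 * B ^ 2 * (2 * E) := by gcongr
    _ = 4 * 1 * (E / lam) + 4 * B ^ 2 * E := by ring
    _ ≤ 4 * B ^ 2 * (E / lam) + 4 * B ^ 2 * E := by
        have : 1 ≤ B ^ 2 := by nlinarith
        gcongr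
    _ = _ := by ring

/-- The constant of the final estimate. -/
def bigC (lam B : ℝ) : ℝ :=
  4 * (1200 * B ^ 3 * (1 + 1 / lam)) * (16 * B / lam + 4 * B ^ 2 * (1 + 1 / lam))

theorem one_le_bigC (hb : P.Bounds lam B) : 1 ≤ bigC lam B := by
  have hlam := hb.lam_pos
  have hB := hb.one_le
  have h1 := hb.one_le_one_add
  have h2 : 1 ≤ B ^ 3 := one_le_pow₀ hB
  have h3 : 1 ≤ B ^ 2 := one_le_pow₀ hB
  have h4 : 0 ≤ 16 * B / lam := by positivity
  have h5 : 1 ≤ B ^ 3 * (1 + 1 / lam) := one_le_mul_of_one_le_of_one_le h2 h1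
  have h6 : 1 ≤ B ^ 2 * (1 + 1 / lam) := one_le_mul_of_one_le_of_one_le h3 h1
  unfold bigC
  exact one_le_mul_of_one_le_of_one_le (by linarith) (by linarith)

/-- Choice of the parameter `μ = √E` (approached from above, as `E` may vanish). -/
theorem optimize_le {c A ρ K₁ K₂ E N j₀ a : ℝ} (hc : 1 ≤ c) (hA : 0 ≤ A) (hρ : 0 < ρ)
    (hρ1 : 2 * ρ ≤ 1) (hK₁ : 0 ≤ K₁) (hK₂ : 0 ≤ K₂) (hE : 0 ≤ E) (hN : 0 ≤ N) (hj : 0 ≤ j₀)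
    (main : ∀ μ : ℝ, 0 < μ →
      c * a ≤ c * j₀ + A / ρ ^ 2 * ((√E * N + √E + E + μ) * K₁ + K₂ * E / μ)) :
    (2 * ρ) ^ 2 * a ≤ j₀ + 4 * A * ((2 * K₁ + K₂) * (√E * N + √E + E)) := by
  have hr := Real.sqrt_nonneg E
  have hε : ∀ ε : ℝ, 0 < ε → (2 * ρ) ^ 2 * a ≤
      j₀ + 4 * A * ((√E * N + √E + E + (√E + ε)) * K₁ + K₂ * √E) := fun ε hε => by
    have hμ : 0 < √E + ε := by positivity
    have hEμ : K₂ * E / (√E + ε) ≤ K₂ * √E := by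
      rw [mul_div_assoc]
      refine mul_le_mul_of_nonneg_left ?_ hK₂
      rw [div_le_iff₀ hμ]
      nlinarith [Real.mul_self_sqrt hE]
    have h0 := main (√E + ε) hμ
    set R := (√E * N + √E + E + (√E + ε)) * K₁ + K₂ * √E with hR
    have hR0 : 0 ≤ R := by positivity
    have hRle : A / ρ ^ 2 * ((√E * N + √E + E + (√E + ε)) * K₁ + K₂ * E / (√E + ε)) ≤
        A / ρ ^ 2 * R := mul_le_mul_of_nonneg_left (by rw [hR]; linarith) (by positivity)
    have h2 : 0 ≤ A / ρ ^ 2 * R := by positivity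
    have h1 : a ≤ j₀ + A / ρ ^ 2 * R := by
      rcases le_total a j₀ with h | h
      · linarith
      · have := mul_le_mul_of_nonneg_right hc (sub_nonneg.2 h)
        linarith
    have h4 : (2 * ρ) ^ 2 * (j₀ + A / ρ ^ 2 * R) = (2 * ρ) ^ 2 * j₀ + 4 * A * R := by
      field_simp
      ring
    have h5 : (2 * ρ) ^ 2 ≤ 1 := pow_le_one₀ (by positivity) hρ1
    have h6 : (2 * ρ) ^ 2 * j₀ ≤ j₀ := mul_le_of_le_one_left hj h5
    have h7 := mul_le_mul_of_nonneg_left h1 (sq_nonneg (2 * ρ))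
    linarith
  have hlim : (2 * ρ) ^ 2 * a ≤
      j₀ + 4 * A * ((√E * N + √E + E + (√E + 0)) * K₁ + K₂ * √E) := by
    have hc : Continuous fun ε : ℝ =>
      j₀ + 4 * A * ((√E * N + √E + E + (√E + ε)) * K₁ + K₂ * √E) := by fun_prop
    exact ge_of_tendsto ((hc.tendsto 0).mono_left (nhdsWithin_le_nhds (s := Ioi 0)))
      (eventually_nhdsWithin_of_forall hε)
  refine hlim.trans (add_le_add le_rfl (mul_le_mul_of_nonneg_left ?_ (by positivity)))
  have hrN : 0 ≤ √E * N := by positivity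
  have k1 := mul_nonneg hK₁ hrN
  have k2 := mul_nonneg hK₂ hrN
  have k3 := mul_nonneg hK₁ hE
  have k4 := mul_nonneg hK₂ hE
  linarith

/-- The estimate for `J`. Since `J` is not known to be bounded on the line, the smallness of the
energy is used through the maximum `N` of `(1 - |x - x₁|)² |J|` over a unit window. At a maximum
point the window of half the distance to the boundary loses only a factor on `N`, and the square of
that distance compensates the cutoff. -/
theorem abs_J_le (hb : P.Bounds lam B) (hT1 : T ≤ 1) {E M j₀ : ℝ} (hE : 0 ≤ E)
    (h0 : ∀ a b, a ≤ b → ∫ x in a..b, F.e x 0 ≤ 2 * E)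
    (hM : ∀ t ∈ Icc 0 T, ∀ a b, a ≤ b → ∫ x in a..b, F.e x t ≤ M)
    (hj₀ : ∀ x, |F.J x 0| ≤ j₀) (hsmall : bigC lam B * √E ≤ 1 / 2) (x₁ : ℝ) {t₁ : ℝ}
    (ht₁ : t₁ ∈ Icc 0 T) :
    |F.J x₁ t₁| ≤ 2 * (j₀ + bigC lam B * √E + bigC lam B * E) := by
  have hlam := hb.lam_pos
  have hB1 := hb.one_le
  have hB0 : 0 < B := by linarith
  have hj : 0 ≤ j₀ := (abs_nonneg _).trans (hj₀ 0)
  have ce := F.cont_e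
  have cv := F.cont_v
  have cJ := F.cont_J
  have hC := one_le_bigC hb
  have hwin := fun t (ht : t ∈ Icc 0 T) => F.local_energy_le hb h0 hM x₁ ht
  have hv0 : ∀ t ∈ Icc 0 T, 0 ≤ lam / 2 * ∫ r in (0)..t, ∫ x in (x₁ - 1)..(x₁ + 1),
      F.v x r ^ 2 := fun t ht => mul_nonneg (by positivity)
    (intervalIntegral.integral_nonneg ht.1 fun r _ =>
      intervalIntegral.integral_nonneg (by linarith) fun x _ => sq_nonneg _)
  have he0 : ∀ t, 0 ≤ ∫ x in (x₁ - 1)..(x₁ + 1), F.e x t := fun t =>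
    intervalIntegral.integral_nonneg (by linarith) fun x _ => F.e_nonneg x t
  obtain ⟨⟨x₀, t₀⟩, hmem, hmax⟩ := (isCompact_Icc.prod isCompact_Icc).exists_isMaxOn
    (⟨(x₁, t₁), ⟨⟨by linarith, by linarith⟩, ht₁⟩⟩ :
      (Icc (x₁ - 1) (x₁ + 1) ×ˢ Icc 0 T).Nonempty)
    (f := fun y : ℝ × ℝ => (1 - |y.1 - x₁|) ^ 2 * |F.J y.1 y.2|) (by fun_prop)
  have hx₀ : x₀ ∈ Icc (x₁ - 1) (x₁ + 1) := hmem.1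
  have ht₀ : t₀ ∈ Icc 0 T := hmem.2
  set N := (1 - |x₀ - x₁|) ^ 2 * |F.J x₀ t₀| with hNdef
  have hN0 : 0 ≤ N := by positivity
  have hNle : ∀ x ∈ Icc (x₁ - 1) (x₁ + 1), ∀ t ∈ Icc 0 T,
      (1 - |x - x₁|) ^ 2 * |F.J x t| ≤ N := fun x hx t ht => hmax (show (x, t) ∈ _ from ⟨hx, ht⟩)
  have hle : |F.J x₁ t₁| ≤ N := by
    have := hNle x₁ ⟨by linarith, by linarith⟩ t₁ ht₁
    simpa using this
  have hd0 : 0 ≤ 1 - |x₀ - x₁| := by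
    have : |x₀ - x₁| ≤ 1 := abs_le.2 ⟨by linarith [hx₀.1], by linarith [hx₀.2]⟩
    linarith
  have hN : N ≤ j₀ + bigC lam B * (√E * N + √E + E) := by
    rcases hd0.eq_or_lt with hd | hd
    · have : N = 0 := by rw [hNdef, ← hd]; ring
      rw [this]
      have : 0 ≤ bigC lam B * (√E * 0 + √E + E) := by positivity
      linarith
    set ρ := (1 - |x₀ - x₁|) / 2 with hρdef
    have hρ : 0 < ρ := by positivity
    have hρ1 : ρ ≤ 1 := by have := abs_nonneg (x₀ - x₁); rw [hρdef]; linarith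
    have hdρ : 1 - |x₀ - x₁| = 2 * ρ := by rw [hρdef]; ring
    have hsub : ∀ x, |x - x₀| ≤ ρ → |x - x₁| ≤ 1 - ρ := fun x hx => by
      have := abs_sub_le x x₀ x₁
      linarith
    have hla := hsub (x₀ - ρ) (by rw [sub_sub_cancel_left, abs_neg, abs_of_pos hρ])
    have hlb := hsub (x₀ + ρ) (by rw [add_sub_cancel_left, abs_of_pos hρ])
    have hla' : x₁ - 1 ≤ x₀ - ρ := by have := (abs_le.1 hla).1; linarith
    have hlb' : x₀ + ρ ≤ x₁ + 1 := by have := (abs_le.1 hlb).2; linarith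
    have he : ∀ t ∈ Icc 0 T, ∫ x in (x₀ - ρ)..(x₀ + ρ), F.e x t ≤ 2 * E := fun t ht => by
      have h1 : ∫ x in (x₀ - ρ)..(x₀ + ρ), F.e x t ≤ ∫ x in (x₁ - 1)..(x₁ + 1), F.e x t := by
        apply intervalIntegral.integral_mono_interval hla' (by linarith) hlb'
        · exact Eventually.of_forall fun x => F.e_nonneg x t
        · exact (continuous_slice_left ce t).intervalIntegrable _ _
      have := hwin t ht
      have := hv0 t ht
      linarith
    have hv : lam / 2 * ∫ t in (0)..t₀, ∫ x in (x₀ - ρ)..(x₀ + ρ), F.v x t ^ 2 ≤ E := by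
      have h1 : ∫ t in (0)..t₀, ∫ x in (x₀ - ρ)..(x₀ + ρ), F.v x t ^ 2 ≤
          ∫ t in (0)..t₀, ∫ x in (x₁ - 1)..(x₁ + 1), F.v x t ^ 2 := by
        have c := fun a b => continuous_integral_slice (f := fun x t => F.v x t ^ 2)
          (by fun_prop) a b
        apply intervalIntegral.integral_mono_on ht₀.1
        · exact (c _ _).intervalIntegrable _ _
        · exact (c _ _).intervalIntegrable _ _
        · intro t _
          apply intervalIntegral.integral_mono_interval hla' (by linarith) hlb'
          · exact Eventually.of_forall fun x => sq_nonneg _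
          · exact ((continuous_slice_left cv t).pow 2).intervalIntegrable _ _
      have h2 := mul_le_mul_of_nonneg_left h1 (by positivity : 0 ≤ lam / 2)
      have := hwin t₀ ht₀
      have := he0 t₀
      linarith
    have hW := F.integral_J_sq_le hb hT1 hE (by linarith) ht₀ he hv
    -- on the smaller window the weight is still at least `ρ²`
    have hJ : ∀ t ∈ Icc 0 T, ∀ x, |x - x₀| ≤ ρ → |F.J x t| ≤ N / ρ ^ 2 := fun t ht x hx => by
      have h1 := hsub x hx
      have h2 := abs_le.1 h1
      have h3 := hNle x ⟨by linarith, by linarith⟩ t ht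
      have h4 : ρ ^ 2 ≤ (1 - |x - x₁|) ^ 2 := pow_le_pow_left₀ hρ.le (by linarith) 2
      rw [le_div_iff₀ (by positivity)]
      nlinarith [mul_le_mul_of_nonneg_right h4 (abs_nonneg (F.J x t))]
    have hπ : 1 ≤ √(Real.pi * 4) := by
      rw [Real.one_le_sqrt]
      linarith [Real.pi_gt_three]
    have main := optimize_le (a := |F.J x₀ t₀|) (N := N) (K₁ := 8 * B / lam)
      (K₂ := 4 * B ^ 2 * (1 + 1 / lam)) (A := 1200 * B ^ 3 * (1 + 1 / lam)) hπ (by positivity)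
      hρ (by linarith [abs_nonneg (x₀ - x₁)]) (by positivity) (by positivity) hE hN0 hj
      fun μ hμ => F.pointwise_le hb hT1 hρ hρ1 hμ hE hN0 ht₀ he hJ hW hj₀
    rw [← hdρ, ← hNdef] at main
    refine main.trans_eq ?_
    rw [bigC]
    ring
  have h1 : bigC lam B * (√E * N) ≤ 1 / 2 * N := by
    rw [← mul_assoc]
    exact mul_le_mul_of_nonneg_right hsmall hN0
  have h2 : bigC lam B * (√E * N + √E + E) =
      bigC lam B * (√E * N) + bigC lam B * √E + bigC lam B * E := by ring
  linarith

end Flow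

section Solutions

variable {P : Coeffs} {T : ℝ} {θ u : ℝ → ℝ → ℝ}

theorem IsSolution.flow_e (hT : 0 < T) (hS : IsSolution P T θ u) (x : ℝ) {t : ℝ}
    (ht : t ∈ Icc 0 T) : (hS.flow hT).e x t = energyDensity P T θ u x t := by
  change ddt T θ x (clamp T t) ^ 2 + P.k (θ x (clamp T t)) * ddx θ x (clamp T t) ^ 2
    + u x (clamp T t) ^ 2 = _
  rw [clamp_of_mem ht, ← P.c_sq]
  rfl

theorem IsSolution.flow_J (hT : 0 < T) (hS : IsSolution P T θ u) (x : ℝ) {t : ℝ}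
    (ht : t ∈ Icc 0 T) : (hS.flow hT).J x t = J P T θ u x t := by
  change ddx u x (clamp T t) + P.m (θ x (clamp T t)) * ddt T θ x (clamp T t) = _
  rw [clamp_of_mem ht]
  rfl

theorem IsSolution.integral_flow_e_le (hT : 0 < T) (hS : IsSolution P T θ u) {t : ℝ}
    (ht : t ∈ Icc 0 T) {a b : ℝ} (hab : a ≤ b) :
    ∫ x in a..b, (hS.flow hT).e x t ≤ 2 * energy P T θ u t := by
  have h1 : (fun x => (hS.flow hT).e x t) = fun x => energyDensity P T θ u x t :=
    funext fun x => hS.flow_e hT x ht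
  have h2 : 2 * energy P T θ u t = ∫ x, (hS.flow hT).e x t := by
    rw [h1, energy]; ring
  rw [h2, intervalIntegral.integral_of_le hab]
  refine setIntegral_le_integral ?_ (Eventually.of_forall fun x => (hS.flow hT).e_nonneg x t)
  rw [h1]
  exact hS.finite_energy t ht

theorem supNorm_nonneg (f : ℝ → ℝ) : 0 ≤ supNorm f := Real.iSup_nonneg fun _ => abs_nonneg _

end Solutions

end Poiseuille

end

theorem mainTheorem2 (P : Poiseuille.Coeffs) :
    ∃ C C₁ C₂ : ℝ, 0 < C ∧ 0 < C₁ ∧ 0 < C₂ ∧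
      ∀ (T : ℝ), 0 < T → T ≤ 1 →
      ∀ (θ u : ℝ → ℝ → ℝ) (A₀ : ℝ → ℝ),
        Poiseuille.IsSolution P T θ u →
        Poiseuille.IsPotential (fun x => Poiseuille.J P T θ u x 0) A₀ →
        Poiseuille.IsBdd (fun x => Poiseuille.J P T θ u x 0) →
        Poiseuille.IsBdd (fun x => Poiseuille.ddx θ x 0) →
        Poiseuille.IsBdd A₀ →
        C * Real.sqrt (Poiseuille.energy P T θ u 0) ≤ 1 / 2 →
        ∀ x : ℝ, ∀ t ∈ Set.Icc 0 T,
          |Poiseuille.J P T θ u x t| ≤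
            2 * (C * Poiseuille.energy P T θ u 0
              + C * Real.sqrt (Poiseuille.energy P T θ u 0)
              + C * Poiseuille.supNorm (fun y => Poiseuille.J P T θ u y 0)
              + C₁ * Poiseuille.supNorm (fun y => Poiseuille.ddx θ y 0) * Poiseuille.supNorm A₀
              + C₂ * Poiseuille.supNorm A₀) := by
  obtain ⟨lam, B, hb⟩ := P.exists_bounds
  have hC := Poiseuille.Flow.one_le_bigC hb
  refine ⟨Poiseuille.Flow.bigC lam B, 1, 1, by linarith, one_pos, one_pos, ?_⟩
  intro T hT hT1 θ u A₀ hS _ hJ₀ _ _ hsmall x t ht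
  have hmem : (0 : ℝ) ∈ Set.Icc 0 T := ⟨le_rfl, hT.le⟩
  obtain ⟨M, hM⟩ := hS.bounded_energy
  have hE : 0 ≤ Poiseuille.energy P T θ u 0 := by
    have h1 := hS.integral_flow_e_le hT hmem (le_refl (0 : ℝ))
    rw [intervalIntegral.integral_same] at h1
    linarith
  have main := (hS.flow hT).abs_J_le hb hT1 (M := 2 * M)
    (j₀ := Poiseuille.supNorm fun y => Poiseuille.J P T θ u y 0) hE
    (fun a b hab => hS.integral_flow_e_le hT hmem hab)
    (fun s hs a b hab => (hS.integral_flow_e_le hT hs hab).trans (by linarith [hM s hs]))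
    (fun y => by rw [hS.flow_J hT y hmem]; exact le_ciSup hJ₀ y) hsmall x ht
  rw [hS.flow_J hT x ht] at main
  have h1 := Poiseuille.supNorm_nonneg fun y => Poiseuille.J P T θ u y 0
  have h2 := Poiseuille.supNorm_nonneg fun y => Poiseuille.ddx θ y 0
  have h3 := Poiseuille.supNorm_nonneg A₀
  have h4 := mul_nonneg h2 h3
  have h5 := mul_le_mul_of_nonneg_right hC h1
  linarith
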